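/- **Theorem (Morita equivalence of limit spaces).** *Definitions.* An automaton $\Pi$ consists of a finite alphabet $A$, a set $Q$ of states and maps $\sigma:A\times Q\to A$, $\tau:A\times Q\to Q$. It is *invertible* if every $\sigma(-,q)$ is a bijection. A state $q$ acts on words by $\Pi_q(a_1a_2\dots a_n)=\sigma(a_1,q)\,\Pi_{\tau(a_1,q)}(a_2\dots a_n)$, and $\langle\Pi\rangle$ is the group of transformations of $A^*$ generated by the $\Pi_q$. For $g\in\langle\Pi\rangle$, $v\in A^*$, $a\in A$ let $\sigma(a,g)=g(a)$ and let $\tau(v,g)\in\langle\Pi\rangle$ be the section of $g$ at $v$: $g(vw)=g(v)\,\tau(v,g)(w)$ for all $w\in A^*$. $\Pi$ is *contracting* if there is a finite $N\subset\langle\Pi\rangle$ such that for every $g\in\langle\Pi\rangle$ there is $n\ge1$ with $\tau(A^n,g)\subset N$; its *nucleus* is $\bigcup_{g}\bigcap_{n_0\ge0}\bigcup_{n\ge n_0}\tau(A^n,g)$. $\Pi$ is *nuclear* if it is contracting and $q\mapsto\Pi_q$ is a bijection of $Q$ onto the nucleus. $\Pi$ is *smooth* if $\tau$ is surjective and the directed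 graph with vertex set $A$ and an edge from $a$ to $\sigma(a,q)$ whenever $\tau(a,q)$ is the identity state is strongly connected. Automata $\Pi,\Pi'$ with alphabets $A,A'$ are *equivalent* if $\#A=\#A'$ and there is a tree isomorphism $\phi:A^*\to(A')^*$, computed by a finite automaton with input alphabet $A$ and output alphabet $A'$, such that every section of $\phi$ has the form $\phi g$ with $g\in\langle\Pi\rangle$, and $\phi\langle\Pi\rangle\phi^{-1}=\langle\Pi'\rangle$. The *limit space* $L(\Pi)$ is the topological groupoid with objects the sequences $\alpha=(\alpha(n))_{n\le-1}$ in $A$, and arrows the pairs $(\alpha,\phi)$, where $\phi=(\phi(n))_{n\le-1}$ is a sequence in $\langle\Pi\rangle$ taking finitely many values and $\phi(n+1)=\tau(\alpha(n),\phi(n))$ for all $n<-1$. The source of $(\alpha,\phi)$ is $\alpha$, its target is $n\mapsto\sigma(\alpha(n),\phi(n))$, and arrows are composed termwise. Topologies are induced from the product topologies, with $A$ and $\langle\Pi\rangle$ discrete. The shift $f$, $f(\alpha,\phi)(n)=(\alpha(n-1),\phi(n-1))$, is a self-covering of $L(\Pi)$. Here a morphism of topological groupoids is a *covering* if it is a surjective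 covering map on objects and the square it forms with the source maps is a pull-back of topological spaces. Two topological groupoids $G$ (objects $X$) and $G'$ (objects $X'$) with self-coverings $f,f'$ are *Morita equivalent* if there are a topological space $P$ with maps $s_P:P\to X$, $t_P:P\to X'$, and a topological groupoid structure $G''$ with arrow space $G\sqcup P\sqcup P\sqcup G'$, object space $X\sqcup X'$, source $s_G\sqcup s_P\sqcup t_P\sqcup s_{G'}$ and target $t_G\sqcup t_P\sqcup s_P\sqcup t_{G'}$, extending the structures of $G$ and $G'$, such that the maps $P/(p\sim ph,\ h\in G')\to X$ and $P/(p\sim gp,\ g\in G)\to X'$ induced by $s_P$ and $t_P$ are homeomorphisms, and $G''$ admits a self-covering $f''$ which restricts to $f$ on $G$ and to $f'$ on $G'$. *Statement.* Let $\Pi$ and $\Pi'$ be invertible automata with finite alphabets, both nuclear. 1. If $\Pi$ and $\Pi'$ are equivalent, then $(L(\Pi),f)$ and $(L(\Pi'),f')$ are Morita equivalent, where $f,f'$ are the shifts. 2. If moreover $\Pi$ and $\Pi'$ are smooth, then $\Pi$ and $\Pi'$ are equivalent if and only if $(L(\Pi),f)$ and $(L(\Pi'),f')$ are Morita equivalent.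 -/

import Mathlib

open Topology

universe u v w x

/-! ## Automata -/

/-- An automaton with input alphabet `A`, output alphabet `B` and set of states `Q`:
an output function `σ : A × Q → B` and a transition function `τ : A × Q → Q`. -/
structure Transducer (A : Type*) (B : Type*) (Q : Type*) where
  out : A → Q → B
  trans : A → Q → Q

/-- An automaton with alphabet `A` and set of states `Q`. -/
abbrev Automaton (A : Type*) (Q : Type*) := Transducer A A Q

/-- The transformation of words given by an automaton with initial state `q`:
`T_q (a₁ a₂ … aₙ) = σ(a₁, q) T_{τ(a₁, q)} (a₂ … aₙ)`. -/
def Transducer.run {A B Q : Type*} (T : Transducer A B Q) : Q → List A → List B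
  | _, [] => []
  | q, a :: w => T.out a q :: T.run (T.trans a q) w

/-- The section (or state) of a map of words at the word `v`: if `f (v w) = v' f' (w)` with
`v'` as long as `v`, this is `f'`. -/
def wordSection {A B : Type*} (f : List A → List B) (v : List A) : List A → List B :=
  fun w => (f (v ++ w)).drop v.length

/-- Maps of rooted trees: they preserve the length of words and the prefix order. -/
def IsTreeMap {A B : Type*} (f : List A → List B) : Prop :=
  (∀ w, (f w).length = w.length) ∧ ∀ v w, f v <+: f (v ++ w)

theorem IsTreeMap.append {A B : Type*} {f : List A → List B} (hf : IsTreeMap f) (v w : List A) :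
    f (v ++ w) = f v ++ wordSection f v w := by
  obtain ⟨t, ht⟩ := hf.2 v w
  simp only [wordSection]
  rw [← ht, ← hf.1 v, List.drop_left]

theorem IsTreeMap.wordSection {A B : Type*} {f : List A → List B} (hf : IsTreeMap f)
    (v : List A) : IsTreeMap (wordSection f v) := by
  constructor
  · intro w
    have h1 := hf.1 (v ++ w)
    rw [hf.append] at h1
    simp only [List.length_append, hf.1] at h1
    omega
  · intro x y
    have h1 := hf.2 (v ++ x) y
    rw [List.append_assoc, hf.append v x, hf.append v (x ++ y)] at h1
    exact (List.prefix_append_right_inj _).1 h1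

theorem wordSection_bijective {A : Type*} {f : List A → List A} (hf : IsTreeMap f)
    (hb : Function.Bijective f) (v : List A) : Function.Bijective (wordSection f v) := by
  constructor
  · intro x y hxy
    have : f (v ++ x) = f (v ++ y) := by rw [hf.append, hf.append, hxy]
    exact List.append_cancel_left (hb.1 this)
  · intro u
    obtain ⟨x, hx⟩ := hb.2 (f v ++ u)
    have hlen : x.length = v.length + u.length := by
      rw [← hf.1 x, hx, List.length_append, hf.1]
    have h1 := hf.append (x.take v.length) (x.drop v.length)
    rw [List.take_append_drop, hx] at h1
    have h2 : (f v).length = (f (x.take v.length)).length := by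
      rw [hf.1, hf.1, List.length_take, hlen]; omega
    obtain ⟨h3, -⟩ := List.append_inj h1 h2
    have h4 := hb.1 h3
    refine ⟨x.drop v.length, ?_⟩
    rw [← h4] at h1
    exact (List.append_cancel_left h1).symm

theorem Transducer.run_isTreeMap {A B Q : Type*} (T : Transducer A B Q) (q : Q) :
    IsTreeMap (T.run q) := by
  constructor
  · intro w
    induction w generalizing q with
    | nil => rfl
    | cons a w ih => simp [Transducer.run, ih]
  · intro x y
    induction x generalizing q with
    | nil => exact List.nil_prefix
    | cons a x ih => simpa [Transducer.run] using ih (T.trans a q)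

theorem Transducer.wordSection_run {A B Q : Type*} (T : Transducer A B Q) (q : Q)
    (v : List A) : ∃ q', wordSection (T.run q) v = T.run q' := by
  induction v generalizing q with
  | nil => exact ⟨q, by funext w; simp [wordSection]⟩
  | cons a v ih =>
    obtain ⟨q', h⟩ := ih (T.trans a q)
    exact ⟨q', by rw [← h]; funext w; simp [wordSection, Transducer.run]⟩

theorem wordSection_comp {A B C : Type*} {g : List B → List C} {f : List A → List B}
    (hg : IsTreeMap g) (hf : IsTreeMap f) (v : List A) :
    wordSection (g ∘ f) v = wordSection g (f v) ∘ wordSection f v := by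
  funext w
  have h1 : g (f (v ++ w)) = g (f v) ++ wordSection g (f v) (wordSection f v w) := by
    rw [hf.append, hg.append]
  have h2 : (g (f v)).length = v.length := by rw [hg.1, hf.1]
  show (g (f (v ++ w))).drop v.length = _
  rw [h1, ← h2, List.drop_left]
  rfl

theorem IsTreeMap.perm_inv {A : Type*} {g : Equiv.Perm (List A)} (hg : IsTreeMap g) :
    IsTreeMap (⇑g⁻¹) := by
  have hl : ∀ w, (g⁻¹ w).length = w.length := fun w => by
    rw [← hg.1, ← Equiv.Perm.mul_apply, mul_inv_cancel, Equiv.Perm.one_apply]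
  refine ⟨hl, fun x y => ?_⟩
  set z := g⁻¹ (x ++ y) with hz
  have hgz : g z = x ++ y := by
    rw [hz, ← Equiv.Perm.mul_apply, mul_inv_cancel, Equiv.Perm.one_apply]
  have hzl : z.length = x.length + y.length := by rw [hz, hl, List.length_append]
  have h1 := hg.append (z.take x.length) (z.drop x.length)
  rw [List.take_append_drop, hgz] at h1
  have h2 : x.length = (g (z.take x.length)).length := by
    rw [hg.1, List.length_take, hzl]; omega
  obtain ⟨h3, -⟩ := List.append_inj h1 h2
  have h4 : g⁻¹ x = z.take x.length := by
    conv_lhs => rw [h3]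
    rw [← Equiv.Perm.mul_apply, inv_mul_cancel, Equiv.Perm.one_apply]
  rw [h4]
  exact List.take_prefix _ _

namespace Transducer

/-- The automaton is invertible if every `σ(-, q)` is a permutation of the alphabet. -/
def Invertible {A Q : Type*} (M : Automaton A Q) : Prop :=
  ∀ q, Function.Bijective fun a => M.out a q

/-- The group `⟨M⟩` of the automaton: the group of transformations of the tree of words
generated by the transformations given by the states. -/
def group {A Q : Type*} (M : Automaton A Q) : Subgroup (Equiv.Perm (List A)) :=
  Subgroup.closure {g | ∃ q, ⇑g = M.run q}

variable {A : Type u} {Q : Type w} (M : Automaton A Q)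

theorem group_isTreeMap (g : M.group) : IsTreeMap (⇑(g : Equiv.Perm (List A))) := by
  obtain ⟨g, hg⟩ := g
  induction hg using Subgroup.closure_induction with
  | mem x hx =>
    obtain ⟨q, hq⟩ := hx
    simpa [hq] using M.run_isTreeMap q
  | one => exact ⟨fun _ => rfl, fun v w => List.prefix_append v w⟩
  | mul x y _ _ hx hy =>
    refine ⟨fun w => ?_, fun v w => ?_⟩
    · exact (hx.1 _).trans (hy.1 w)
    · obtain ⟨t, ht⟩ := hy.2 v w
      have := hx.2 (y v) t
      rw [ht] at this
      exact this
  | inv x _ hx => exact hx.perm_inv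

theorem exists_section (g : M.group) (v : List A) :
    ∃ h : M.group, ⇑(h : Equiv.Perm (List A)) = wordSection (⇑(g : Equiv.Perm (List A))) v := by
  obtain ⟨g, hg⟩ := g
  induction hg using Subgroup.closure_induction generalizing v with
  | mem x hx =>
    obtain ⟨q, hq⟩ := hx
    obtain ⟨q', hq'⟩ := M.wordSection_run q v
    have hb : Function.Bijective (wordSection (⇑x) v) :=
      wordSection_bijective (hq ▸ M.run_isTreeMap q) x.bijective v
    refine ⟨⟨Equiv.ofBijective _ hb, Subgroup.subset_closure ⟨q', ?_⟩⟩, rfl⟩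
    rw [← hq', ← hq]
    rfl
  | one => exact ⟨1, by funext w; simp [wordSection]⟩
  | mul x y hx hy ihx ihy =>
    obtain ⟨k, hk⟩ := ihx (y v)
    obtain ⟨l, hl⟩ := ihy v
    refine ⟨k * l, ?_⟩
    have := wordSection_comp (M.group_isTreeMap ⟨x, hx⟩) (M.group_isTreeMap ⟨y, hy⟩) v
    simp only at this hk hl
    rw [← hk, ← hl] at this
    exact this.symm
  | inv x hx ih =>
    obtain ⟨k, hk⟩ := ih (x⁻¹ v)
    refine ⟨k⁻¹, ?_⟩
    have h1 := wordSection_comp (M.group_isTreeMap ⟨x, hx⟩) (M.group_isTreeMap ⟨x⁻¹, inv_mem hx⟩) v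
    simp only at h1 hk
    rw [← hk] at h1
    have h2 : (⇑x ∘ ⇑x⁻¹ : List A → List A) = id := by
      funext w; simp
    rw [h2] at h1
    funext w
    have h3 := congrFun h1 w
    simp only [wordSection, id, List.drop_left, Function.comp_apply] at h3
    have h4 : (k : Equiv.Perm (List A))⁻¹ w =
        (k : Equiv.Perm (List A))⁻¹ ((k : Equiv.Perm (List A))
          (((x⁻¹ : Equiv.Perm (List A)) (v ++ w)).drop v.length)) := by rw [← h3]
    rw [← Equiv.Perm.mul_apply, inv_mul_cancel, Equiv.Perm.one_apply] at h4
    exact h4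

/-- The section `τ(v, g)` of an element `g` of the group of the automaton at the word `v`. -/
noncomputable def tau (v : List A) (g : M.group) : M.group := (M.exists_section g v).choose

theorem coe_tau (v : List A) (g : M.group) :
    ⇑(M.tau v g : Equiv.Perm (List A)) = wordSection (⇑(g : Equiv.Perm (List A))) v :=
  (M.exists_section g v).choose_spec

/-- The action `σ(a, g)` of an element `g` of the group of the automaton on letters. -/
def sigma (a : A) (g : M.group) : A :=
  ((g : Equiv.Perm (List A)) [a]).head (by
    intro h
    have := (M.group_isTreeMap g).1 [a]
    rw [h] at this
    simp at this)

/-- The automaton is contracting: there is a finite set `N` in its group such that each `g` in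
the group has all its sections at some level `n ≥ 1` in `N`. -/
def Contracting : Prop :=
  ∃ N : Set M.group, N.Finite ∧
    ∀ g : M.group, ∃ n : ℕ, 1 ≤ n ∧ ∀ v : List A, v.length = n → M.tau v g ∈ N

/-- The nucleus `⋃_g ⋂_{n₀ ≥ 0} ⋃_{n ≥ n₀} τ(Aⁿ, g)`. -/
def nucleus : Set M.group :=
  ⋃ g : M.group, ⋂ n₀ : ℕ, ⋃ n ≥ n₀, {h | ∃ v : List A, v.length = n ∧ M.tau v g = h}

/-- The automaton is nuclear: it is contracting and `q ↦ M_q` identifies its set of states with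
its nucleus. -/
def Nuclear : Prop :=
  M.Contracting ∧ ∃ e : Q ≃ M.nucleus, ∀ q, ⇑((e q : M.group) : Equiv.Perm (List A)) = M.run q

/-- The automaton is smooth: `τ` is surjective, and the graph on the alphabet with an edge from
`a` to `σ(a, q)` for each state `q` with `τ(a, q)` the identity state is strongly connected. -/
def Smooth : Prop :=
  (∀ q, ∃ a p, M.trans a p = q) ∧
    ∀ a b, Relation.ReflTransGen
      (fun a b => ∃ q, M.out a q = b ∧ M.run (M.trans a q) = id) a b

/-- Equivalence of automata: the alphabets have the same cardinality, and there is a tree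
isomorphism `φ` given by a finite automaton, all of whose states are of the form `φ g` with
`g ∈ ⟨M⟩`, such that `φ ⟨M⟩ φ⁻¹ = ⟨M'⟩`. -/
def Equivalent {A : Type u} {Q : Type*} {A' : Type v} {Q' : Type*}
    (M : Automaton A Q) (M' : Automaton A' Q') : Prop :=
  Nonempty (A ≃ A') ∧ ∃ φ : List A ≃ List A',
    (∃ (S : Type) (_ : Finite S) (T : Transducer A A' S) (s : S), ⇑φ = T.run s) ∧
    (∀ v : List A, ∃ g ∈ M.group, wordSection (⇑φ) v = ⇑φ ∘ ⇑g) ∧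
    (fun g : Equiv.Perm (List A) => φ.permCongr g) '' (M.group : Set (Equiv.Perm (List A))) =
      (M'.group : Set (Equiv.Perm (List A')))

end Transducer

/-! ## Topological groupoids -/

/-- A topological groupoid with space of objects `X` and space of arrows `G`. The product `g h`
is defined when the target of `g` is the source of `h`. -/
structure TopGroupoid (X : Type u) (G : Type u) [TopologicalSpace X] [TopologicalSpace G] where
  src : G → X
  tgt : G → X
  one : X → G
  inv : G → G
  mul : (g h : G) → tgt g = src h → G
  src_one : ∀ x, src (one x) = x
  tgt_one : ∀ x, tgt (one x) = x
  src_inv : ∀ g, src (inv g) = tgt g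
  tgt_inv : ∀ g, tgt (inv g) = src g
  src_mul : ∀ g h e, src (mul g h e) = src g
  tgt_mul : ∀ g h e, tgt (mul g h e) = tgt h
  mul_assoc : ∀ g h k (e₁ : tgt g = src h) (e₂ : tgt h = src k),
    mul (mul g h e₁) k ((tgt_mul g h e₁).trans e₂) =
      mul g (mul h k e₂) (e₁.trans (src_mul h k e₂).symm)
  one_mul : ∀ g, mul (one (src g)) g (tgt_one _) = g
  mul_one : ∀ g, mul g (one (tgt g)) (src_one _).symm = g
  mul_inv : ∀ g, mul g (inv g) (src_inv g).symm = one (src g)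
  inv_mul : ∀ g, mul (inv g) g (tgt_inv g) = one (tgt g)
  continuous_src : Continuous src
  continuous_tgt : Continuous tgt
  continuous_one : Continuous one
  continuous_inv : Continuous inv
  continuous_mul : Continuous fun p : {p : G × G // tgt p.1 = src p.2} => mul p.1.1 p.1.2 p.2

namespace TopGroupoid

/-- Morphisms of topological groupoids. -/
structure Hom {X G : Type u} [TopologicalSpace X] [TopologicalSpace G]
    {Y H : Type v} [TopologicalSpace Y] [TopologicalSpace H]
    (𝒢 : TopGroupoid X G) (ℋ : TopGroupoid Y H) where
  arr : G → H
  obj : X → Y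
  continuous_arr : Continuous arr
  continuous_obj : Continuous obj
  map_src : ∀ g, obj (𝒢.src g) = ℋ.src (arr g)
  map_tgt : ∀ g, obj (𝒢.tgt g) = ℋ.tgt (arr g)
  map_inv : ∀ g, arr (𝒢.inv g) = ℋ.inv (arr g)
  map_mul : ∀ g h (e : 𝒢.tgt g = 𝒢.src h),
    arr (𝒢.mul g h e) =
      ℋ.mul (arr g) (arr h) ((map_tgt g).symm.trans ((congrArg obj e).trans (map_src h)))

/-- A morphism of topological groupoids is a covering if it is a covering on objects and the
square formed by the source maps is a pull-back square of topological spaces. -/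
def Hom.IsCovering {X G : Type u} [TopologicalSpace X] [TopologicalSpace G]
    {Y H : Type v} [TopologicalSpace Y] [TopologicalSpace H]
    {𝒢 : TopGroupoid X G} {ℋ : TopGroupoid Y H} (F : Hom 𝒢 ℋ) : Prop :=
  IsCoveringMap F.obj ∧ Function.Surjective F.obj ∧
    IsHomeomorph (fun g => ⟨(𝒢.src g, F.arr g), F.map_src g⟩ :
      G → {p : X × H // F.obj p.1 = ℋ.src p.2})

/-- Self-coverings of a topological groupoid. -/
structure SelfCovering {X G : Type u} [TopologicalSpace X] [TopologicalSpace G]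
    (𝒢 : TopGroupoid X G) extends Hom 𝒢 𝒢 where
  isCovering : toHom.IsCovering

section Morita

variable {X G : Type u} [TopologicalSpace X] [TopologicalSpace G]
  {X' G' : Type v} [TopologicalSpace X'] [TopologicalSpace G']

/-- A topological space `P` with maps `s_P : P → X` and `t_P : P → X'`, and a structure of
topological groupoid on the spaces `G ⊔ P ⊔ P ⊔ G'` of arrows and `X ⊔ X'` of objects, with source
map `s_G ⊔ s_P ⊔ t_P ⊔ s_{G'}` and target map `t_G ⊔ t_P ⊔ s_P ⊔ t_{G'}`, which extends the
structures of `G` and of `G'`. -/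
structure Linking (𝒢 : TopGroupoid X G) (𝒢' : TopGroupoid X' G')
    (P : Type (max u v)) [TopologicalSpace P] where
  srcP : P → X
  tgtP : P → X'
  total : TopGroupoid (X ⊕ X') (G ⊕ P ⊕ P ⊕ G')
  src_eq : total.src =
    Sum.elim (fun g => Sum.inl (𝒢.src g)) (Sum.elim (fun p => Sum.inl (srcP p))
      (Sum.elim (fun p => Sum.inr (tgtP p)) (fun h => Sum.inr (𝒢'.src h))))
  tgt_eq : total.tgt =
    Sum.elim (fun g => Sum.inl (𝒢.tgt g)) (Sum.elim (fun p => Sum.inr (tgtP p))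
      (Sum.elim (fun p => Sum.inl (srcP p)) (fun h => Sum.inr (𝒢'.tgt h))))
  mul_left : ∀ g h (e : 𝒢.tgt g = 𝒢.src h) e',
    total.mul (Sum.inl g) (Sum.inl h) e' = Sum.inl (𝒢.mul g h e)
  mul_right : ∀ g h (e : 𝒢'.tgt g = 𝒢'.src h) e',
    total.mul (Sum.inr (Sum.inr (Sum.inr g))) (Sum.inr (Sum.inr (Sum.inr h))) e' =
      Sum.inr (Sum.inr (Sum.inr (𝒢'.mul g h e)))

variable {𝒢 : TopGroupoid X G} {𝒢' : TopGroupoid X' G'}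
  {P : Type (max u v)} [TopologicalSpace P]

/-- The relation `p ∼ p h` on `P`, with `h` an arrow of `G'`. -/
def Linking.RelRight (L : Linking 𝒢 𝒢' P) (p q : P) : Prop :=
  ∃ (h : G') (e : L.total.tgt (Sum.inr (Sum.inl p)) =
      L.total.src (Sum.inr (Sum.inr (Sum.inr h)))),
    L.total.mul (Sum.inr (Sum.inl p)) (Sum.inr (Sum.inr (Sum.inr h))) e = Sum.inr (Sum.inl q)

/-- The relation `p ∼ g p` on `P`, with `g` an arrow of `G`. -/
def Linking.RelLeft (L : Linking 𝒢 𝒢' P) (p q : P) : Prop :=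
  ∃ (g : G) (e : L.total.tgt (Sum.inl g) = L.total.src (Sum.inr (Sum.inl p))),
    L.total.mul (Sum.inl g) (Sum.inr (Sum.inl p)) e = Sum.inr (Sum.inl q)

theorem Linking.srcP_eq (L : Linking 𝒢 𝒢' P) (p q : P) (h : L.RelRight p q) :
    L.srcP p = L.srcP q := by
  obtain ⟨k, e, hk⟩ := h
  have h1 := L.total.src_mul _ _ e
  rw [hk] at h1
  simp only [L.src_eq, Sum.elim_inr, Sum.elim_inl, Sum.inl.injEq] at h1
  exact h1.symm

theorem Linking.tgtP_eq (L : Linking 𝒢 𝒢' P) (p q : P) (h : L.RelLeft p q) :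
    L.tgtP p = L.tgtP q := by
  obtain ⟨k, e, hk⟩ := h
  have h1 := L.total.tgt_mul _ _ e
  rw [hk] at h1
  simp only [L.tgt_eq, Sum.elim_inr, Sum.elim_inl, Sum.inr.injEq] at h1
  exact h1.symm

/-- The maps `P / (p ∼ p h) → X` and `P / (p ∼ g p) → X'` given by `s_P` and `t_P` are
homeomorphisms. -/
def Linking.IsMorita (L : Linking 𝒢 𝒢' P) : Prop :=
  IsHomeomorph (Quot.lift L.srcP L.srcP_eq : Quot L.RelRight → X) ∧
    IsHomeomorph (Quot.lift L.tgtP L.tgtP_eq : Quot L.RelLeft → X')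

/-- Morita equivalence of topological groupoids with self-coverings: there is a Morita
equivalence of the groupoids, and a self-covering of the groupoid on `G ⊔ P ⊔ P ⊔ G'` which
restricts to the given self-coverings of `G` and `G'`. -/
def MoritaEquivalent (f : SelfCovering 𝒢) (f' : SelfCovering 𝒢') : Prop :=
  ∃ (P : Type (max u v)) (_ : TopologicalSpace P) (L : Linking 𝒢 𝒢' P) (F : SelfCovering L.total),
    L.IsMorita ∧
    (∀ x, F.obj (Sum.inl x) = Sum.inl (f.obj x)) ∧
    (∀ x, F.obj (Sum.inr x) = Sum.inr (f'.obj x)) ∧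
    (∀ g, F.arr (Sum.inl g) = Sum.inl (f.arr g)) ∧
    (∀ g, F.arr (Sum.inr (Sum.inr (Sum.inr g))) = Sum.inr (Sum.inr (Sum.inr (f'.arr g))))

end Morita

end TopGroupoid

/-! ## Limit spaces -/

/-- Sequences `(α(n))` indexed by the negative integers, with values in the discrete space `S`.
The entry `α k` is the term of index `n = -(k + 1)`. -/
def NegSeq (S : Type u) : Type u := ℕ → S

/-- The product topology, with `S` discrete. -/
instance NegSeq.topologicalSpace (S : Type u) : TopologicalSpace (NegSeq S) :=
  @Pi.topologicalSpace ℕ (fun _ => S) fun _ => ⊥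

theorem NegSeq.continuous_iff {S : Type u} {Y : Type*} [TopologicalSpace Y] {f : Y → NegSeq S} :
    Continuous f ↔ ∀ k, IsLocallyConstant fun y => f y k := by
  let _ : TopologicalSpace S := ⊥
  have : DiscreteTopology S := ⟨rfl⟩
  have h : Continuous f ↔ ∀ k, Continuous fun y => f y k :=
    @continuous_pi_iff Y ℕ (fun _ => S) _ (fun _ => ⊥) f
  rw [h]
  exact forall_congr' fun k => (IsLocallyConstant.iff_continuous _).symm

theorem NegSeq.eval {S : Type u} (k : ℕ) : IsLocallyConstant fun α : NegSeq S => α k :=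
  NegSeq.continuous_iff.1 continuous_id k

namespace Transducer

variable {A : Type u} {Q : Type w} (M : Automaton A Q)

theorem apply_singleton (a : A) (g : M.group) :
    (g : Equiv.Perm (List A)) [a] = [M.sigma a g] := by
  have h := (M.group_isTreeMap g).1 [a]
  obtain ⟨b, hb⟩ := List.length_eq_one_iff.1 h
  simp [sigma, hb]

theorem sigma_one (a : A) : M.sigma a 1 = a := by
  have h := M.apply_singleton a 1
  simpa using h.symm

theorem sigma_mul (a : A) (g h : M.group) : M.sigma a (g * h) = M.sigma (M.sigma a h) g := by
  have h1 := M.apply_singleton a (g * h)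
  rw [Subgroup.coe_mul, Equiv.Perm.mul_apply, apply_singleton, apply_singleton] at h1
  simpa using h1.symm

theorem tau_one (v : List A) : M.tau v 1 = 1 := by
  apply Subtype.ext
  apply DFunLike.coe_injective
  rw [coe_tau]
  funext w
  simp [wordSection]

theorem tau_mul (a : A) (g h : M.group) :
    M.tau [a] (g * h) = M.tau [M.sigma a h] g * M.tau [a] h := by
  apply Subtype.ext
  apply DFunLike.coe_injective
  rw [coe_tau]
  have := wordSection_comp (M.group_isTreeMap g) (M.group_isTreeMap h) [a]
  rw [apply_singleton, ← coe_tau, ← coe_tau] at this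
  exact this

theorem tau_inv (a : A) (g : M.group) : M.tau [M.sigma a g] g⁻¹ = (M.tau [a] g)⁻¹ := by
  have h := M.tau_mul a g⁻¹ g
  rw [inv_mul_cancel, tau_one] at h
  exact eq_inv_of_mul_eq_one_left h.symm

/-- The arrows of the limit space: pairs `(α, φ)` of sequences indexed by the negative integers,
with values in the alphabet and in the group of the automaton, such that
`φ(n + 1) = τ(α(n), φ(n))` for all `n < -1` and `φ` takes finitely many values. They have the
topology induced by the product topology. -/
def LimitArrow : Type u :=
  {p : NegSeq A × NegSeq M.group //
    (∀ k : ℕ, p.2 k = M.tau [p.1 (k + 1)] (p.2 (k + 1))) ∧ (Set.range p.2).Finite}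

instance : TopologicalSpace M.LimitArrow := instTopologicalSpaceSubtype

variable {M}

theorem LimitArrow.locallyConstant_fst (k : ℕ) :
    IsLocallyConstant fun p : M.LimitArrow => p.1.1 k :=
  (NegSeq.eval k).comp_continuous (continuous_fst.comp continuous_subtype_val)

theorem LimitArrow.locallyConstant_snd (k : ℕ) :
    IsLocallyConstant fun p : M.LimitArrow => p.1.2 k :=
  (NegSeq.eval k).comp_continuous (continuous_snd.comp continuous_subtype_val)

theorem LimitArrow.continuous_iff {Y : Type*} [TopologicalSpace Y] {f : Y → M.LimitArrow} :
    Continuous f ↔ (∀ k, IsLocallyConstant fun y => (f y).1.1 k) ∧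
      ∀ k, IsLocallyConstant fun y => (f y).1.2 k := by
  have h1 : Continuous f ↔ Continuous fun y => ((f y).1.1, (f y).1.2) := continuous_induced_rng
  rw [h1, continuous_prodMk, NegSeq.continuous_iff, NegSeq.continuous_iff]

/-- Functions of finitely many locally constant functions are locally constant. -/
theorem locallyConstant_map₂ {Y S T R : Type*} [TopologicalSpace Y] {f : Y → S} {g : Y → T}
    (hf : IsLocallyConstant f) (hg : IsLocallyConstant g) (F : S → T → R) :
    IsLocallyConstant fun y => F (f y) (g y) :=
  (hf.prodMk hg).comp fun p => F p.1 p.2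

variable (M)

/-- The target `t(α, φ)(n) = σ(α(n), φ(n))` of an arrow of the limit space. -/
def LimitArrow.target (p : M.LimitArrow) : NegSeq A := fun k => M.sigma (p.1.1 k) (p.1.2 k)

/-- The limit space of the automaton, as a topological groupoid: the objects are the sequences of
letters indexed by the negative integers, the source of `(α, φ)` is `α`, its target is
`n ↦ σ(α(n), φ(n))`, and the product of `(α, φ)` and `(β, ψ)` is `(α, ψ φ)`, where `ψ φ` acts by
`φ` first. -/
noncomputable def limitSpace : TopGroupoid (NegSeq A) M.LimitArrow where
  src p := p.1.1
  tgt p := LimitArrow.target M p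
  one α := ⟨(α, fun _ => 1), fun k => (M.tau_one _).symm,
    (Set.finite_singleton (1 : M.group)).subset (Set.range_subset_iff.2 fun _ => rfl)⟩
  inv p := ⟨(LimitArrow.target M p, fun k => (p.1.2 k)⁻¹), fun k => by
      show (p.1.2 k)⁻¹ = M.tau [M.sigma (p.1.1 (k + 1)) (p.1.2 (k + 1))] (p.1.2 (k + 1))⁻¹
      rw [tau_inv, ← p.2.1 k],
    (p.2.2.image fun g => g⁻¹).subset (Set.range_subset_iff.2 fun k => ⟨_, ⟨k, rfl⟩, rfl⟩)⟩
  mul p q e := ⟨(p.1.1, fun k => q.1.2 k * p.1.2 k), fun k => by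
      show q.1.2 k * p.1.2 k = M.tau [p.1.1 (k + 1)] (q.1.2 (k + 1) * p.1.2 (k + 1))
      have h : M.sigma (p.1.1 (k + 1)) (p.1.2 (k + 1)) = q.1.1 (k + 1) := congrFun e (k + 1)
      rw [tau_mul, h, ← p.2.1 k, ← q.2.1 k],
    (q.2.2.image2 (fun g h => g * h) p.2.2).subset
      (Set.range_subset_iff.2 fun k => ⟨_, ⟨k, rfl⟩, _, ⟨k, rfl⟩, rfl⟩)⟩
  src_one α := rfl
  tgt_one α := funext fun k => M.sigma_one _
  src_inv p := rfl
  tgt_inv p := funext fun k => by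
    show M.sigma (M.sigma (p.1.1 k) (p.1.2 k)) (p.1.2 k)⁻¹ = p.1.1 k
    rw [← sigma_mul, inv_mul_cancel, sigma_one]
  src_mul p q e := rfl
  tgt_mul p q e := funext fun k => by
    show M.sigma (p.1.1 k) (q.1.2 k * p.1.2 k) = M.sigma (q.1.1 k) (q.1.2 k)
    have h : M.sigma (p.1.1 k) (p.1.2 k) = q.1.1 k := congrFun e k
    rw [sigma_mul, h]
  mul_assoc p q r _ _ := Subtype.ext (Prod.ext rfl (funext fun k => (_root_.mul_assoc _ _ _).symm))
  one_mul p := Subtype.ext (Prod.ext rfl (funext fun k => _root_.mul_one _))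
  mul_one p := Subtype.ext (Prod.ext rfl (funext fun k => _root_.one_mul _))
  mul_inv p := Subtype.ext (Prod.ext rfl (funext fun k => inv_mul_cancel (p.1.2 k)))
  inv_mul p := Subtype.ext (Prod.ext rfl (funext fun k => mul_inv_cancel (p.1.2 k)))
  continuous_src := continuous_fst.comp continuous_subtype_val
  continuous_tgt := NegSeq.continuous_iff.2 fun k =>
    locallyConstant_map₂ (LimitArrow.locallyConstant_fst k) (LimitArrow.locallyConstant_snd k) _
  continuous_one := LimitArrow.continuous_iff.2
    ⟨fun k => NegSeq.eval k, fun k => IsLocallyConstant.const 1⟩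
  continuous_inv := LimitArrow.continuous_iff.2
    ⟨fun k => locallyConstant_map₂ (LimitArrow.locallyConstant_fst k)
        (LimitArrow.locallyConstant_snd k) fun a g => M.sigma a g,
      fun k => (LimitArrow.locallyConstant_snd k).comp fun g => g⁻¹⟩
  continuous_mul := by
    have h₁ : Continuous fun y : {p : M.LimitArrow × M.LimitArrow //
        LimitArrow.target M p.1 = p.2.1.1} => y.1.1 := continuous_fst.comp continuous_subtype_val
    have h₂ : Continuous fun y : {p : M.LimitArrow × M.LimitArrow //
        LimitArrow.target M p.1 = p.2.1.1} => y.1.2 := continuous_snd.comp continuous_subtype_val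
    refine LimitArrow.continuous_iff.2 ⟨fun k => ?_, fun k => ?_⟩
    · have h := (LimitArrow.locallyConstant_fst k).comp_continuous h₁
      exact h
    · have h := locallyConstant_map₂ ((LimitArrow.locallyConstant_snd k).comp_continuous h₂)
        ((LimitArrow.locallyConstant_snd k).comp_continuous h₁) fun g h => g * h
      exact h

/-- The shift `f(α)(n) = α(n - 1)` of sequences indexed by the negative integers. -/
def _root_.NegSeq.shift {S : Type*} (α : NegSeq S) : NegSeq S := fun k => α (k + 1)

/-- The shift `f(α, φ)(n) = (α(n - 1), φ(n - 1))` of the limit space. -/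
noncomputable def shiftHom : TopGroupoid.Hom M.limitSpace M.limitSpace where
  arr p := ⟨(p.1.1.shift, p.1.2.shift), fun k => p.2.1 (k + 1),
    p.2.2.subset (Set.range_subset_iff.2 fun k => ⟨k + 1, rfl⟩)⟩
  obj α := α.shift
  continuous_arr := LimitArrow.continuous_iff.2
    ⟨fun k => LimitArrow.locallyConstant_fst (k + 1),
      fun k => LimitArrow.locallyConstant_snd (k + 1)⟩
  continuous_obj := NegSeq.continuous_iff.2 fun k => NegSeq.eval (k + 1)
  map_src _ := rfl
  map_tgt _ := rfl
  map_inv _ := rfl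
  map_mul _ _ _ := rfl

theorem _root_.NegSeq.isCoveringMap_shift (S : Type*) :
    IsCoveringMap (NegSeq.shift : NegSeq S → NegSeq S) := by
  intro α
  let _ : TopologicalSpace S := ⊥
  have : DiscreteTopology S := ⟨rfl⟩
  apply IsEvenlyCovered.to_isEvenlyCovered_preimage (I := S)
  refine ⟨inferInstance, Set.univ, trivial, isOpen_univ, isOpen_univ, ?_⟩
  refine ⟨{ toFun := fun x => (⟨x.1.shift, trivial⟩, x.1 0)
            invFun := fun y => ⟨fun k => Nat.casesOn k y.2 y.1.1, trivial⟩
            left_inv := fun x => ?_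
            right_inv := fun y => rfl
            continuous_toFun := ?_
            continuous_invFun := ?_ }, fun x => rfl⟩
  · apply Subtype.ext
    funext k
    cases k <;> rfl
  · refine Continuous.prodMk (Continuous.subtype_mk ?_ _) ?_
    · exact NegSeq.continuous_iff.2 fun k =>
        (NegSeq.eval (k + 1)).comp_continuous continuous_subtype_val
    · exact ((NegSeq.eval 0).comp_continuous continuous_subtype_val).continuous
  · refine Continuous.subtype_mk (NegSeq.continuous_iff.2 fun k => ?_) _
    cases k with
    | zero => exact (IsLocallyConstant.iff_continuous _).2 continuous_snd
    | succ k =>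
      exact (NegSeq.eval k).comp_continuous (continuous_subtype_val.comp continuous_fst)

theorem shiftHom_isCovering : M.shiftHom.IsCovering := by
  refine ⟨NegSeq.isCoveringMap_shift A, fun α => ?_, ?_⟩
  · by_cases h : Nonempty A
    · exact ⟨fun k => Nat.casesOn k h.some α, rfl⟩
    · exact (h ⟨α 0⟩).elim
  · rw [isHomeomorph_iff_exists_inverse]
    refine ⟨?_, fun y => ⟨(y.1.1, fun k => Nat.casesOn k
        (M.tau [y.1.2.1.1 0] (y.1.2.1.2 0)) y.1.2.1.2), ?_, ?_⟩, fun p => ?_, fun y => ?_, ?_⟩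
    · exact Continuous.subtype_mk (Continuous.prodMk M.limitSpace.continuous_src
        M.shiftHom.continuous_arr) _
    · obtain ⟨⟨α, p⟩, h⟩ := y
      have hk : ∀ k, α (k + 1) = p.1.1 k := fun k => congrFun h k
      intro k
      cases k with
      | zero =>
        show M.tau [p.1.1 0] (p.1.2 0) = M.tau [α (0 + 1)] (p.1.2 0)
        rw [hk]
      | succ k =>
        show p.1.2 k = M.tau [α (k + 1 + 1)] (p.1.2 (k + 1))
        rw [hk, ← p.2.1 k]
    · refine ((Set.finite_singleton (M.tau [y.1.2.1.1 0] (y.1.2.1.2 0))).union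
        y.1.2.2.2).subset (Set.range_subset_iff.2 fun k => ?_)
      cases k with
      | zero => exact Or.inl rfl
      | succ k => exact Or.inr ⟨k, rfl⟩
    · apply Subtype.ext
      refine Prod.ext rfl (funext fun k => ?_)
      cases k with
      | zero => exact (p.2.1 0).symm
      | succ k => rfl
    · obtain ⟨⟨α, p⟩, h⟩ := y
      apply Subtype.ext
      refine Prod.ext rfl (Subtype.ext (Prod.ext ?_ rfl))
      exact h
    · refine LimitArrow.continuous_iff.2 ⟨fun k => ?_, fun k => ?_⟩
      · have hc : Continuous fun y : {p : NegSeq A × M.LimitArrow //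
            M.shiftHom.obj p.1 = M.limitSpace.src p.2} => y.1.1 :=
          continuous_fst.comp continuous_subtype_val
        have h := (NegSeq.eval k).comp_continuous hc
        exact h
      · have hc : Continuous fun y : {p : NegSeq A × M.LimitArrow //
            M.shiftHom.obj p.1 = M.limitSpace.src p.2} => y.1.2 :=
          continuous_snd.comp continuous_subtype_val
        cases k with
        | zero =>
          exact locallyConstant_map₂ ((LimitArrow.locallyConstant_fst 0).comp_continuous hc)
            ((LimitArrow.locallyConstant_snd 0).comp_continuous hc) fun a g => M.tau [a] g
        | succ k => exact (LimitArrow.locallyConstant_snd k).comp_continuous hc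

/-- The shift, as a self-covering of the limit space. -/
noncomputable def limitShift : TopGroupoid.SelfCovering M.limitSpace where
  toHom := M.shiftHom
  isCovering := M.shiftHom_isCovering

end Transducer

universe z

/-! ## Locally constant maps and sequences with values in discrete spaces -/

theorem IsLocallyConstant.isClopen_setOf {Y S : Type*} [TopologicalSpace Y] {f : Y → S}
    (hf : IsLocallyConstant f) (R : S → Prop) : IsClopen {y | R (f y)} :=
  ⟨⟨hf {s | ¬ R s}⟩, hf {s | R s}⟩

namespace NegSeq

variable {S : Type*}

instance : T2Space (NegSeq S) := by
  let _ : TopologicalSpace S := ⊥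
  have : DiscreteTopology S := ⟨rfl⟩
  exact inferInstanceAs (T2Space (ℕ → S))

theorem isCompact_of_finite {K : Set S} (hK : K.Finite) :
    IsCompact {α : NegSeq S | ∀ k, α k ∈ K} := by
  let _ : TopologicalSpace S := ⊥
  have : DiscreteTopology S := ⟨rfl⟩
  have h : IsCompact (Set.univ.pi fun _ : ℕ => K) := isCompact_univ_pi fun _ => hK.isCompact
  have e : {α : NegSeq S | ∀ k, α k ∈ K} = Set.univ.pi fun _ : ℕ => K := by
    ext α
    exact ⟨fun h k _ => h k, fun h k => h k trivial⟩
  rw [e]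
  exact h

instance [Finite S] : CompactSpace (NegSeq S) :=
  ⟨by simpa using isCompact_of_finite (Set.finite_univ (α := S))⟩

/-- The sequence with last term `a` preceded by `α`. -/
def cons (a : S) (α : NegSeq S) : NegSeq S := fun k => Nat.casesOn k a α

@[simp] theorem shift_cons (a : S) (α : NegSeq S) : (cons a α).shift = α := rfl

theorem cons_shift (α : NegSeq S) : cons (α 0) α.shift = α := by
  funext k; cases k <;> rfl

theorem eq_cons {α β : NegSeq S} {a : S} (h : α.shift = β) (h0 : α 0 = a) : α = cons a β := by
  rw [← h, ← h0, cons_shift]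

theorem finite_range_cons (a : S) {α : NegSeq S} (h : (Set.range α).Finite) :
    (Set.range (cons a α)).Finite := by
  refine (h.insert a).subset (Set.range_subset_iff.2 fun k => ?_)
  cases k with
  | zero => exact Or.inl rfl
  | succ k => exact Or.inr ⟨k, rfl⟩

theorem continuous_shift : Continuous (shift : NegSeq S → NegSeq S) :=
  continuous_iff.2 fun k => eval (k + 1)

theorem continuous_cons (a : S) : Continuous (cons a) :=
  continuous_iff.2 fun k => by
    cases k with
    | zero => exact IsLocallyConstant.const a
    | succ k => exact eval k

end NegSeq

/-! ## Contracting automata -/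

namespace Transducer

variable {A : Type u} {Q : Type w} (M : Automaton A Q)

theorem group_ext {g h : M.group}
    (e : ∀ w, (g : Equiv.Perm (List A)) w = (h : Equiv.Perm (List A)) w) : g = h :=
  Subtype.ext (Equiv.ext e)

theorem tau_append (v w : List A) (g : M.group) : M.tau (v ++ w) g = M.tau w (M.tau v g) := by
  apply M.group_ext
  intro u
  simp [coe_tau, wordSection]

theorem tau_nil (g : M.group) : M.tau [] g = g := by
  apply M.group_ext
  intro u
  simp [coe_tau, wordSection]

theorem apply_append (g : M.group) (v w : List A) : (g : Equiv.Perm (List A)) (v ++ w) =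
    (g : Equiv.Perm (List A)) v ++ (M.tau v g : Equiv.Perm (List A)) w := by
  rw [coe_tau, (M.group_isTreeMap g).append]

theorem apply_cons (g : M.group) (a : A) (w : List A) : (g : Equiv.Perm (List A)) (a :: w) =
    M.sigma a g :: (M.tau [a] g : Equiv.Perm (List A)) w := by
  rw [← List.singleton_append, apply_append, apply_singleton]
  rfl

theorem apply_nil (g : M.group) : (g : Equiv.Perm (List A)) [] = [] :=
  List.length_eq_zero_iff.1 ((M.group_isTreeMap g).1 [])

theorem sigma_inv_sigma (a : A) (g : M.group) : M.sigma (M.sigma a g) g⁻¹ = a := by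
  rw [← sigma_mul, inv_mul_cancel, sigma_one]

theorem sigma_sigma_inv (a : A) (g : M.group) : M.sigma (M.sigma a g⁻¹) g = a := by
  rw [← sigma_mul, mul_inv_cancel, sigma_one]

variable {M}

/-- The sections of elements of the group of a contracting automaton eventually belong to a
finite set. -/
theorem Contracting.exists_finite [Finite A] (hM : M.Contracting) : ∃ N : Set M.group, N.Finite ∧
    ∀ g : M.group, ∃ n₀ : ℕ, ∀ v : List A, n₀ ≤ v.length → M.tau v g ∈ N := by
  obtain ⟨N, hN, h⟩ := hM
  choose n hn1 hn using h
  obtain ⟨m, hm⟩ := (hN.image n).bddAbove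
  have hm : ∀ g ∈ N, n g ≤ m := fun g hg => hm ⟨g, hg, rfl⟩
  refine ⟨Set.image2 (fun v g => M.tau v g) {v | v.length ≤ m} N,
    Set.Finite.image2 _ (List.finite_length_le A m) hN, ?_⟩
  have key : ∀ l : ℕ, ∀ v : List A, v.length ≤ l → ∀ g ∈ N,
      M.tau v g ∈ Set.image2 (fun v g => M.tau v g) {v : List A | v.length ≤ m} N := by
    intro l
    induction l with
    | zero => exact fun v hv g hg => ⟨v, by simp only [Set.mem_ofPred_eq]; omega, g, hg, rfl⟩
    | succ l ih =>
      intro v hv g hg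
      by_cases hvm : v.length ≤ m
      · exact ⟨v, hvm, g, hg, rfl⟩
      · have h1 := hm g hg
        have h2 := hn1 g
        rw [← List.take_append_drop (n g) v, tau_append]
        refine ih _ (by simp only [List.length_drop]; omega) _ (hn g _ ?_)
        simp only [List.length_take]; omega
  intro g
  refine ⟨n g, fun v hv => ?_⟩
  rw [← List.take_append_drop (n g) v, tau_append]
  exact key _ _ le_rfl _ (hn g _ (by simp only [List.length_take]; omega))

theorem Nuclear.finite [Finite A] (hM : M.Nuclear) : Finite Q := by
  obtain ⟨hc, e, -⟩ := hM
  obtain ⟨N, hN, h⟩ := hc.exists_finite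
  have hsub : M.nucleus ⊆ N := by
    intro g hg
    simp only [nucleus, Set.mem_iUnion, Set.mem_iInter] at hg
    obtain ⟨k, hk⟩ := hg
    obtain ⟨n₀, h0⟩ := h k
    obtain ⟨n, hn, v, hv, rfl⟩ := hk n₀
    exact h0 v (by omega)
  have := (hN.subset hsub).to_subtype
  exact Finite.of_equiv _ e.symm

theorem exists_tau_eq {α : NegSeq A} {φ : NegSeq M.group}
    (h : ∀ k, φ k = M.tau [α (k + 1)] (φ (k + 1))) (k n : ℕ) :
    ∃ v : List A, v.length = n ∧ φ k = M.tau v (φ (k + n)) := by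
  induction n with
  | zero => exact ⟨[], rfl, (M.tau_nil _).symm⟩
  | succ n ih =>
    obtain ⟨v, hv, e⟩ := ih
    refine ⟨α (k + n + 1) :: v, by simp [hv], ?_⟩
    rw [e, h (k + n), ← tau_append]
    rfl

theorem Contracting.exists_finite_arrow [Finite A] (hM : M.Contracting) :
    ∃ N : Set M.group, N.Finite ∧ ∀ (p : M.LimitArrow) (k : ℕ), p.1.2 k ∈ N := by
  obtain ⟨N, hN, h⟩ := hM.exists_finite
  refine ⟨N, hN, fun p k => ?_⟩
  choose n hn using h
  obtain ⟨m, hm⟩ := (p.2.2.image n).bddAbove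
  obtain ⟨v, hv, e⟩ := exists_tau_eq p.2.1 k m
  rw [e]
  exact hn _ _ ((hm ⟨_, ⟨_, rfl⟩, rfl⟩).trans hv.ge)

instance : T2Space M.LimitArrow := inferInstanceAs (T2Space {_p : NegSeq A × NegSeq M.group // _})

theorem Contracting.compactSpace_limitArrow [Finite A] (hM : M.Contracting) :
    CompactSpace M.LimitArrow := by
  obtain ⟨N, hN, h⟩ := hM.exists_finite_arrow
  refine isCompact_iff_compactSpace.1 ?_
  have e : {p : NegSeq A × NegSeq M.group | (∀ k : ℕ, p.2 k = M.tau [p.1 (k + 1)] (p.2 (k + 1))) ∧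
      (Set.range p.2).Finite} = (Set.univ ×ˢ {φ : NegSeq M.group | ∀ k, φ k ∈ N}) ∩
      ⋂ k, {p : NegSeq A × NegSeq M.group | p.2 k = M.tau [p.1 (k + 1)] (p.2 (k + 1))} := by
    ext p
    simp only [Set.mem_ofPred_eq, Set.mem_inter_iff, Set.mem_prod, Set.mem_univ, true_and,
      Set.mem_iInter]
    exact ⟨fun hp => ⟨fun k => h ⟨p, hp⟩ k, hp.1⟩,
      fun hp => ⟨hp.2, hN.subset (Set.range_subset_iff.2 hp.1)⟩⟩
  have hc : IsCompact {p : NegSeq A × NegSeq M.group |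
      (∀ k : ℕ, p.2 k = M.tau [p.1 (k + 1)] (p.2 (k + 1))) ∧ (Set.range p.2).Finite} := by
    rw [e]
    refine (isCompact_univ.prod (NegSeq.isCompact_of_finite hN)).inter_right
      (isClosed_iInter fun k => ?_)
    have h1 := (NegSeq.continuous_iff.1 continuous_snd k :
      IsLocallyConstant fun p : NegSeq A × NegSeq M.group => p.2 k)
    have h2 := (NegSeq.continuous_iff.1 continuous_snd (k + 1) :
      IsLocallyConstant fun p : NegSeq A × NegSeq M.group => p.2 (k + 1))
    have h3 := (NegSeq.continuous_iff.1 continuous_fst (k + 1) :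
      IsLocallyConstant fun p : NegSeq A × NegSeq M.group => p.1 (k + 1))
    exact ((h1.prodMk (h2.prodMk h3)).isClopen_setOf
      fun q => q.1 = M.tau [q.2.2] q.2.1).isClosed
  exact hc

end Transducer

namespace Transducer

variable {A : Type u} {Q : Type w} (M : Automaton A Q)

/-- The pair of letters with coefficients `x`, `y` is compatible with the group elements `γ'` and
`γ` if `γ' x = y γ` in the bimodule `A × ⟨M⟩`. -/
def Step (x y : A × M.group) (γ' γ : M.group) : Prop :=
  M.sigma x.1 γ' = y.1 ∧ M.tau [x.1] γ' * x.2 = y.2 * γ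

variable {M}

theorem Step.one (x : A × M.group) : M.Step x x 1 1 := by
  simp [Step, sigma_one, tau_one]

theorem Step.mul {x y z : A × M.group} {γ' γ δ' δ : M.group} (h : M.Step x y γ' γ)
    (k : M.Step y z δ' δ) : M.Step x z (δ' * γ') (δ * γ) := by
  obtain ⟨h1, h2⟩ := h
  obtain ⟨k1, k2⟩ := k
  refine ⟨by rw [sigma_mul, h1, k1], ?_⟩
  rw [tau_mul, mul_assoc, h2, h1, ← mul_assoc, k2, mul_assoc]

theorem Step.inv {x y : A × M.group} {γ' γ : M.group} (h : M.Step x y γ' γ) :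
    M.Step y x γ'⁻¹ γ⁻¹ := by
  obtain ⟨h1, h2⟩ := h
  refine ⟨by rw [← h1, sigma_inv_sigma], ?_⟩
  rw [← h1, tau_inv, inv_mul_eq_iff_eq_mul, ← mul_assoc, h2, mul_inv_cancel_right]

theorem Step.eq {x y : A × M.group} {γ' γ : M.group} (h : M.Step x y γ' γ) :
    γ = y.2⁻¹ * (M.tau [x.1] γ' * x.2) := by
  rw [h.2, inv_mul_cancel_left]

/-- `γ' x = y γ` in terms of words. -/
theorem step_iff {x y : A × M.group} {γ' γ : M.group} : M.Step x y γ' γ ↔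
    ∀ u, (γ' : Equiv.Perm (List A)) (x.1 :: (x.2 : Equiv.Perm (List A)) u) =
      y.1 :: (y.2 : Equiv.Perm (List A)) ((γ : Equiv.Perm (List A)) u) := by
  simp only [apply_cons, List.cons.injEq, Step]
  refine ⟨fun h u => ⟨h.1, ?_⟩, fun h => ⟨(h []).1, M.group_ext fun u => (h u).2⟩⟩
  have := congrArg (fun g : M.group => (g : Equiv.Perm (List A)) u) h.2
  exact this

variable (M) in
/-- A space `Y` of sequences of letters with coefficients in the group, with a shift. -/
structure CodedSpace (Y : Type (max u v)) [TopologicalSpace Y] where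
  code : Y → ℕ → A × M.group
  locallyConstant_code : ∀ k, IsLocallyConstant fun y => code y k
  shift : Y → Y
  continuous_shift : Continuous shift
  code_shift : ∀ y k, code (shift y) k = code y (k + 1)
  pre : A → Y → Y
  continuous_pre : ∀ a, Continuous (pre a)
  shift_pre : ∀ a y, shift (pre a y) = y
  code_pre : ∀ a y, (code (pre a y) 0).1 = a
  pre_shift : ∀ y, pre (code y 0).1 (shift y) = y

namespace CodedSpace

variable {Y : Type (max u v)} [TopologicalSpace Y] (C : CodedSpace.{u, v} M Y)

/-- The condition that a sequence of group elements transforms `x` into `y`. -/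
def Rel (x y : Y) (γ : NegSeq M.group) : Prop :=
  (∀ k, M.Step (C.code x k) (C.code y k) (γ (k + 1)) (γ k)) ∧ (Set.range γ).Finite

theorem Rel.one (x : Y) : C.Rel x x fun _ => 1 :=
  ⟨fun _ => Step.one _,
    (Set.finite_singleton (1 : M.group)).subset (Set.range_subset_iff.2 fun _ => rfl)⟩

variable {C}

theorem Rel.mul {x y z : Y} {γ δ : NegSeq M.group} (h : C.Rel x y γ) (k : C.Rel y z δ) :
    C.Rel x z fun n => δ n * γ n :=
  ⟨fun n => (h.1 n).mul (k.1 n), (k.2.image2 (fun g h => g * h) h.2).subset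
    (Set.range_subset_iff.2 fun k => ⟨_, ⟨k, rfl⟩, _, ⟨k, rfl⟩, rfl⟩)⟩

theorem Rel.inv {x y : Y} {γ : NegSeq M.group} (h : C.Rel x y γ) : C.Rel y x fun n => (γ n)⁻¹ :=
  ⟨fun n => (h.1 n).inv,
    (h.2.image fun g => g⁻¹).subset (Set.range_subset_iff.2 fun k => ⟨_, ⟨k, rfl⟩, rfl⟩)⟩

theorem Rel.shift {x y : Y} {γ : NegSeq M.group} (h : C.Rel x y γ) :
    C.Rel (C.shift x) (C.shift y) γ.shift :=
  ⟨fun n => by rw [C.code_shift, C.code_shift]; exact h.1 (n + 1),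
    h.2.subset (Set.range_subset_iff.2 fun k => ⟨k + 1, rfl⟩)⟩

variable (C)

/-- The arrows of the groupoid of a coded space. -/
def Arrow : Type (max u v) := {t : (Y × Y) × NegSeq M.group // C.Rel t.1.1 t.1.2 t.2}

instance : TopologicalSpace C.Arrow := instTopologicalSpaceSubtype

theorem continuous_arrow {Z : Type*} [TopologicalSpace Z] {f : Z → C.Arrow} : Continuous f ↔
    (Continuous fun z => (f z).1.1.1) ∧ (Continuous fun z => (f z).1.1.2) ∧
      ∀ k, IsLocallyConstant fun z => (f z).1.2 k := by
  have h1 : Continuous f ↔ Continuous fun z => (((f z).1.1.1, (f z).1.1.2), (f z).1.2) :=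
    continuous_induced_rng
  rw [h1, continuous_prodMk, continuous_prodMk, NegSeq.continuous_iff, and_assoc]

theorem Arrow.ext {s t : C.Arrow} (h1 : s.1.1.1 = t.1.1.1) (h2 : s.1.1.2 = t.1.1.2)
    (h3 : ∀ k, s.1.2 k = t.1.2 k) : s = t :=
  Subtype.ext (Prod.ext (Prod.ext h1 h2) (funext h3))

theorem continuous_fst : Continuous fun t : C.Arrow => t.1.1.1 :=
  (C.continuous_arrow.1 continuous_id).1

theorem continuous_snd : Continuous fun t : C.Arrow => t.1.1.2 :=
  (C.continuous_arrow.1 continuous_id).2.1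

theorem locallyConstant_snd (k : ℕ) : IsLocallyConstant fun t : C.Arrow => t.1.2 k :=
  (C.continuous_arrow.1 continuous_id).2.2 k

/-- The groupoid of a coded space. -/
def groupoid : TopGroupoid.{max u v} Y C.Arrow where
  src t := t.1.1.1
  tgt t := t.1.1.2
  one x := ⟨((x, x), fun _ => 1), Rel.one C x⟩
  inv t := ⟨((t.1.1.2, t.1.1.1), fun k => (t.1.2 k)⁻¹), t.2.inv⟩
  mul s t e := ⟨((s.1.1.1, t.1.1.2), fun k => t.1.2 k * s.1.2 k),
    Rel.mul (y := s.1.1.2) s.2 (by have := t.2; rwa [← e] at this)⟩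
  src_one _ := rfl
  tgt_one _ := rfl
  src_inv _ := rfl
  tgt_inv _ := rfl
  src_mul _ _ _ := rfl
  tgt_mul _ _ _ := rfl
  mul_assoc _ _ _ _ _ := Arrow.ext C rfl rfl fun _ => (_root_.mul_assoc _ _ _).symm
  one_mul _ := Arrow.ext C rfl rfl fun _ => _root_.mul_one _
  mul_one _ := Arrow.ext C rfl rfl fun _ => _root_.one_mul _
  mul_inv _ := Arrow.ext C rfl rfl fun _ => inv_mul_cancel _
  inv_mul _ := Arrow.ext C rfl rfl fun _ => mul_inv_cancel _
  continuous_src := C.continuous_fst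
  continuous_tgt := C.continuous_snd
  continuous_one := C.continuous_arrow.2
    ⟨continuous_id, continuous_id, fun _ => IsLocallyConstant.const _⟩
  continuous_inv := C.continuous_arrow.2 ⟨C.continuous_snd, C.continuous_fst,
    fun k => (C.locallyConstant_snd k).comp fun g => g⁻¹⟩
  continuous_mul := by
    have h₁ : Continuous fun y : {p : C.Arrow × C.Arrow // p.1.1.1.2 = p.2.1.1.1} => y.1.1 :=
      _root_.continuous_fst.comp continuous_subtype_val
    have h₂ : Continuous fun y : {p : C.Arrow × C.Arrow // p.1.1.1.2 = p.2.1.1.1} => y.1.2 :=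
      _root_.continuous_snd.comp continuous_subtype_val
    have h₃ := C.continuous_fst.comp h₁
    have h₄ := C.continuous_snd.comp h₂
    have h₅ := fun k => locallyConstant_map₂ ((C.locallyConstant_snd k).comp_continuous h₂)
      ((C.locallyConstant_snd k).comp_continuous h₁) fun g h => g * h
    exact C.continuous_arrow.2 ⟨h₃, h₄, h₅⟩

/-- The shift of the groupoid of a coded space. -/
def shiftHom : TopGroupoid.Hom C.groupoid C.groupoid where
  arr t := ⟨((C.shift t.1.1.1, C.shift t.1.1.2), t.1.2.shift), t.2.shift⟩
  obj := C.shift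
  continuous_arr := C.continuous_arrow.2 ⟨C.continuous_shift.comp C.continuous_fst,
    C.continuous_shift.comp C.continuous_snd, fun k => C.locallyConstant_snd (k + 1)⟩
  continuous_obj := C.continuous_shift
  map_src _ := rfl
  map_tgt _ := rfl
  map_inv _ := rfl
  map_mul _ _ _ := rfl

theorem continuous_pre_of {Z : Type*} [TopologicalSpace Z] {f : Z → A} {g : Z → Y}
    (hf : IsLocallyConstant f) (hg : Continuous g) : Continuous fun z => C.pre (f z) (g z) := by
  refine continuous_iff_continuousAt.2 fun z => ?_
  have h := (C.continuous_pre (f z)).comp hg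
  refine (h.continuousAt (x := z)).congr ?_
  filter_upwards [(IsLocallyConstant.iff_eventually_eq f).1 hf z] with z' hz'
  rw [Function.comp_apply, hz']

theorem isCoveringMap_shift : IsCoveringMap C.shift := by
  intro x
  let _ : TopologicalSpace A := ⊥
  have : DiscreteTopology A := ⟨rfl⟩
  apply IsEvenlyCovered.to_isEvenlyCovered_preimage (I := A)
  refine ⟨inferInstance, Set.univ, trivial, isOpen_univ, isOpen_univ, ?_⟩
  refine ⟨{ toFun := fun y => (⟨C.shift y.1, trivial⟩, (C.code y.1 0).1)
            invFun := fun y => ⟨C.pre y.2 y.1.1, trivial⟩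
            left_inv := fun y => Subtype.ext (C.pre_shift _)
            right_inv := fun y => Prod.ext (Subtype.ext (C.shift_pre _ _)) (C.code_pre _ _)
            continuous_toFun := ?_
            continuous_invFun := ?_ }, fun x => rfl⟩
  · refine Continuous.prodMk (Continuous.subtype_mk
      (C.continuous_shift.comp continuous_subtype_val) _) ?_
    exact (((C.locallyConstant_code 0).comp Prod.fst).comp_continuous
      continuous_subtype_val).continuous
  · exact Continuous.subtype_mk (C.continuous_pre_of
      ((IsLocallyConstant.iff_continuous _).2 _root_.continuous_snd)
      (continuous_subtype_val.comp _root_.continuous_fst)) _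

theorem code_pre_succ (a : A) (y : Y) (k : ℕ) : C.code (C.pre a y) (k + 1) = C.code y k := by
  rw [← C.code_shift, C.shift_pre]

/-- The lift of an arrow starting at `x`. -/
theorem Rel.lift {x x' y : Y} {γ : NegSeq M.group} (h : C.Rel x' y γ) (hx : C.shift x = x') :
    C.Rel x (C.pre (M.sigma (C.code x 0).1 (γ 0)) y)
      (NegSeq.cons ((C.code (C.pre (M.sigma (C.code x 0).1 (γ 0)) y) 0).2⁻¹ *
        (M.tau [(C.code x 0).1] (γ 0) * (C.code x 0).2)) γ) := by
  refine ⟨fun k => ?_, ?_⟩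
  · cases k with
    | zero =>
      refine ⟨(C.code_pre _ _).symm, ?_⟩
      show M.tau [(C.code x 0).1] (γ 0) * (C.code x 0).2 = _ * (_ * _)
      rw [mul_inv_cancel_left]
    | succ k =>
      have := h.1 k
      rw [← hx, C.code_shift] at this
      rw [C.code_pre_succ]
      exact this
  · exact NegSeq.finite_range_cons _ h.2

theorem shiftHom_isCovering : C.shiftHom.IsCovering := by
  refine ⟨C.isCoveringMap_shift, fun y => ⟨C.pre (C.code y 0).1 y, C.shift_pre _ _⟩, ?_⟩
  rw [isHomeomorph_iff_exists_inverse]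
  refine ⟨Continuous.subtype_mk (Continuous.prodMk C.groupoid.continuous_src
    C.shiftHom.continuous_arr) _, fun y => ⟨((_, _), _), Rel.lift C y.1.2.2 y.2⟩, fun t => ?_,
    fun y => ?_, ?_⟩
  · have h0 := t.2.1 0
    have h1 : C.pre (M.sigma (C.code t.1.1.1 0).1 (t.1.2 1)) (C.shift t.1.1.2) = t.1.1.2 := by
      rw [h0.1, C.pre_shift]
    refine Arrow.ext C rfl h1 fun k => ?_
    cases k with
    | zero =>
      show (C.code (C.pre (M.sigma (C.code t.1.1.1 0).1 (t.1.2 1)) (C.shift t.1.1.2)) 0).2⁻¹ * _ = _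
      rw [h1]
      exact h0.eq.symm
    | succ k => rfl
  · apply Subtype.ext
    exact Prod.ext rfl (Arrow.ext C y.2 (C.shift_pre _ _) fun k => rfl)
  · have hc : Continuous fun y : {p : Y × C.Arrow //
        C.shiftHom.obj p.1 = C.groupoid.src p.2} => y.1.1 :=
      _root_.continuous_fst.comp continuous_subtype_val
    have hd : Continuous fun y : {p : Y × C.Arrow //
        C.shiftHom.obj p.1 = C.groupoid.src p.2} => y.1.2 :=
      _root_.continuous_snd.comp continuous_subtype_val
    have h0 := (C.locallyConstant_code 0).comp_continuous hc
    have hγ := fun k => (C.locallyConstant_snd k).comp_continuous hd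
    have hp := C.continuous_pre_of (locallyConstant_map₂ h0 (hγ 0) fun c g => M.sigma c.1 g)
      (C.continuous_snd.comp hd)
    refine C.continuous_arrow.2 ⟨hc, hp, fun k => ?_⟩
    cases k with
    | zero =>
      exact locallyConstant_map₂ ((C.locallyConstant_code 0).comp_continuous hp)
        (locallyConstant_map₂ h0 (hγ 0) fun c g => M.tau [c.1] g * c.2) fun c g => c.2⁻¹ * g
    | succ k => exact hγ k

end CodedSpace

end Transducer

namespace TopGroupoid

variable {X G : Type u} [TopologicalSpace X] [TopologicalSpace G] {H : Type u} [TopologicalSpace H]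

/-- The transport of the structure of a groupoid along a homeomorphism of spaces of arrows. -/
def comap (𝒢 : TopGroupoid X G) (e : H ≃ₜ G) : TopGroupoid X H where
  src g := 𝒢.src (e g)
  tgt g := 𝒢.tgt (e g)
  one x := e.symm (𝒢.one x)
  inv g := e.symm (𝒢.inv (e g))
  mul g h k := e.symm (𝒢.mul (e g) (e h) k)
  src_one x := by simp [𝒢.src_one]
  tgt_one x := by simp [𝒢.tgt_one]
  src_inv g := by simp [𝒢.src_inv]
  tgt_inv g := by simp [𝒢.tgt_inv]
  src_mul g h k := by simp [𝒢.src_mul]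
  tgt_mul g h k := by simp [𝒢.tgt_mul]
  mul_assoc g h k e₁ e₂ := by simpa using 𝒢.mul_assoc (e g) (e h) (e k) e₁ e₂
  one_mul g := by simp [𝒢.one_mul]
  mul_one g := by simp [𝒢.mul_one]
  mul_inv g := by simp [𝒢.mul_inv]
  inv_mul g := by simp [𝒢.inv_mul]
  continuous_src := 𝒢.continuous_src.comp e.continuous
  continuous_tgt := 𝒢.continuous_tgt.comp e.continuous
  continuous_one := e.symm.continuous.comp 𝒢.continuous_one
  continuous_inv := e.symm.continuous.comp (𝒢.continuous_inv.comp e.continuous)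
  continuous_mul := by
    have h : Continuous fun p : {p : H × H // 𝒢.tgt (e p.1) = 𝒢.src (e p.2)} =>
        (⟨(e p.1.1, e p.1.2), p.2⟩ : {p : G × G // 𝒢.tgt p.1 = 𝒢.src p.2}) := by
      refine Continuous.subtype_mk (Continuous.prodMk ?_ ?_) _
      · exact e.continuous.comp (continuous_fst.comp continuous_subtype_val)
      · exact e.continuous.comp (continuous_snd.comp continuous_subtype_val)
    exact e.symm.continuous.comp (𝒢.continuous_mul.comp h)

/-- The transport of a self-covering along a homeomorphism of spaces of arrows. -/
def SelfCovering.comap {𝒢 : TopGroupoid X G} (F : SelfCovering 𝒢) (e : H ≃ₜ G) :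
    SelfCovering (𝒢.comap e) where
  arr g := e.symm (F.arr (e g))
  obj := F.obj
  continuous_arr := e.symm.continuous.comp (F.continuous_arr.comp e.continuous)
  continuous_obj := F.continuous_obj
  map_src g := by simp [TopGroupoid.comap, F.map_src]
  map_tgt g := by simp [TopGroupoid.comap, F.map_tgt]
  map_inv g := by simp [TopGroupoid.comap, F.map_inv]
  map_mul g h k := by simp [TopGroupoid.comap, F.map_mul]
  isCovering := by
    refine ⟨F.isCovering.1, F.isCovering.2.1, ?_⟩
    let E : {p : X × G // F.obj p.1 = 𝒢.src p.2} ≃ₜ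
        {p : X × H // F.obj p.1 = 𝒢.src (e p.2)} :=
      ((Homeomorph.refl X).prodCongr e.symm).subtype fun p => by simp
    exact E.isHomeomorph.comp (F.isCovering.2.2.comp e.isHomeomorph)

end TopGroupoid

namespace Transducer

variable {A : Type u} {Q : Type w} {A' : Type v} {Q' : Type x}

/-- A tree isomorphism which conjugates the group of `M` to the group of `M'`, has finitely many
sections, and whose sections at letters are in its coset. -/
structure TreeConj (M : Automaton A Q) (M' : Automaton A' Q') where
  map : List A ≃ List A'
  isTreeMap : IsTreeMap ⇑map
  finite_section : (Set.range fun v => wordSection (⇑map) v).Finite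
  letter : A ≃ A'
  coeff : A → M.group
  map_cons : ∀ a u, map (a :: u) = letter a :: map ((coeff a : Equiv.Perm (List A)) u)
  conj : M.group ≃* M'.group
  conj_map : ∀ g u, (conj g : Equiv.Perm (List A')) (map u) = map ((g : Equiv.Perm (List A)) u)

theorem exists_letter_equiv {φ : List A ≃ List A'} (ht : IsTreeMap ⇑φ) :
    ∃ l : A ≃ A', ∀ a, φ [a] = [l a] := by
  have hlen : ∀ a, ∃ b, φ [a] = [b] := fun a => List.length_eq_one_iff.1 (ht.1 [a])
  choose l hl using hlen
  refine ⟨Equiv.ofBijective l ⟨fun a b hab => ?_, fun b => ?_⟩, hl⟩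
  · have : φ [a] = φ [b] := by rw [hl, hl, hab]
    simpa using this
  · have h1 : (φ.symm [b]).length = 1 := by rw [← ht.1, Equiv.apply_symm_apply]; rfl
    obtain ⟨a, ha⟩ := List.length_eq_one_iff.1 h1
    have h2 := hl a
    rw [← ha, Equiv.apply_symm_apply] at h2
    exact ⟨a, by simpa using h2.symm⟩

theorem Equivalent.exists_treeConj {M : Automaton A Q} {M' : Automaton A' Q'}
    (h : M.Equivalent M') : Nonempty (TreeConj M M') := by
  obtain ⟨-, φ, ⟨S, _, T, s, hT⟩, hs, hc⟩ := h
  have ht : IsTreeMap ⇑φ := hT ▸ T.run_isTreeMap s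
  obtain ⟨l, hl⟩ := exists_letter_equiv ht
  have hs' : ∀ a, ∃ g : M.group, wordSection (⇑φ) [a] = ⇑φ ∘ ⇑(g : Equiv.Perm (List A)) :=
    fun a => let ⟨g, hg, e⟩ := hs [a]; ⟨⟨g, hg⟩, e⟩
  choose κ hκ using hs'
  have hmem : ∀ g : M.group, φ.permCongr (g : Equiv.Perm (List A)) ∈ M'.group := fun g => by
    have : φ.permCongr (g : Equiv.Perm (List A)) ∈ (M'.group : Set (Equiv.Perm (List A'))) :=
      hc ▸ ⟨g, g.2, rfl⟩
    exact this
  let c : M.group →* M'.group :=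
    { toFun := fun g => ⟨φ.permCongr (g : Equiv.Perm (List A)), hmem g⟩
      map_one' := Subtype.ext (by ext1 u; simp)
      map_mul' := fun g h => Subtype.ext (by ext1 u; simp) }
  have hcb : Function.Bijective c := by
    constructor
    · intro g h hgh
      exact Subtype.ext (φ.permCongr.injective (congrArg Subtype.val hgh))
    · intro h
      have h2 : (h : Equiv.Perm (List A')) ∈ (M'.group : Set (Equiv.Perm (List A'))) := h.2
      rw [← hc] at h2
      obtain ⟨g, hg, e⟩ := h2
      exact ⟨⟨g, hg⟩, Subtype.ext e⟩
  refine ⟨⟨φ, ht, ?_, l, κ, fun a u => ?_, MulEquiv.ofBijective c hcb,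
    fun g u => ?_⟩⟩
  · refine (Set.finite_range fun s => T.run s).subset (Set.range_subset_iff.2 fun v => ?_)
    obtain ⟨q, hq⟩ := T.wordSection_run s v
    exact ⟨q, by rw [hT, hq]⟩
  · rw [← List.singleton_append, ht.append, hl, hκ]
    rfl
  · show φ.permCongr (g : Equiv.Perm (List A)) (φ u) = _
    simp

namespace TreeConj

variable {M : Automaton A Q} {M' : Automaton A' Q'} (D : TreeConj M M')

def lam (b : A') : A × M.group := (D.letter.symm b, (D.coeff (D.letter.symm b))⁻¹)

theorem map_lam (b : A') (u : List A) :
    D.map ((D.lam b).1 :: ((D.lam b).2 : Equiv.Perm (List A)) u) = b :: D.map u := by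
  rw [D.map_cons]
  simp [lam]

theorem step_inl_inr {a : A} {b : A'} {γ δ : M.group} : M.Step (a, 1) (D.lam b) γ δ ↔
    ∀ u, D.map ((γ : Equiv.Perm (List A)) (a :: u)) =
      b :: D.map ((δ : Equiv.Perm (List A)) u) := by
  rw [step_iff]
  refine forall_congr' fun u => ?_
  rw [← D.map_lam, D.map.injective.eq_iff]
  rfl

theorem step_inr_inr {b b' : A'} {γ δ : M.group} : M.Step (D.lam b) (D.lam b') γ δ ↔
    M'.Step (b, 1) (b', 1) (D.conj γ) (D.conj δ) := by
  rw [step_iff, step_iff, ← D.map.forall_congr_right]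
  refine forall_congr' fun u => ?_
  rw [← D.map.injective.eq_iff, D.map_lam, ← D.conj_map, D.map_lam, ← D.conj_map]
  rfl

/-- The disjoint union of the spaces of objects of the limit spaces. -/
def codedSpace : CodedSpace.{u, v} M (NegSeq A ⊕ NegSeq A') where
  code := Sum.elim (fun α k => (α k, 1)) (fun β k => D.lam (β k))
  locallyConstant_code k := by
    let _ : TopologicalSpace (A × M.group) := ⊥
    have : DiscreteTopology (A × M.group) := ⟨rfl⟩
    rw [IsLocallyConstant.iff_continuous, continuous_sum_dom]
    exact ⟨((NegSeq.eval k).comp fun a => (a, 1)).continuous,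
      ((NegSeq.eval k).comp D.lam).continuous⟩
  shift := Sum.map NegSeq.shift NegSeq.shift
  continuous_shift := NegSeq.continuous_shift.sumMap NegSeq.continuous_shift
  code_shift y k := by cases y <;> rfl
  pre a := Sum.map (NegSeq.cons a) (NegSeq.cons (D.letter a))
  continuous_pre a := (NegSeq.continuous_cons _).sumMap (NegSeq.continuous_cons _)
  shift_pre a y := by cases y <;> rfl
  code_pre a y := by cases y <;> simp [lam, NegSeq.cons]
  pre_shift y := by
    cases y with
    | inl α => exact congrArg Sum.inl (NegSeq.cons_shift α)
    | inr β =>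
      refine congrArg Sum.inr ?_
      show NegSeq.cons (D.letter (D.letter.symm (β 0))) _ = _
      rw [Equiv.apply_symm_apply]
      exact NegSeq.cons_shift β

/-- The space of arrows from the first limit space to the second one. -/
def Bitorsor : Type (max u v) := {t : (NegSeq A × NegSeq A') × NegSeq M.group //
  D.codedSpace.Rel (Sum.inl t.1.1) (Sum.inr t.1.2) t.2}

instance : TopologicalSpace D.Bitorsor := instTopologicalSpaceSubtype

theorem continuous_bitorsor_snd (k : ℕ) : IsLocallyConstant fun p : D.Bitorsor => p.1.2 k :=
  (NegSeq.eval k).comp_continuous (continuous_snd.comp continuous_subtype_val)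

/-- The arrows of the linking groupoid, as arrows of the groupoid of a coded space. -/
noncomputable def toArrow : M.LimitArrow ⊕ D.Bitorsor ⊕ D.Bitorsor ⊕ M'.LimitArrow →
    D.codedSpace.Arrow :=
  Sum.elim (fun g => ⟨((Sum.inl g.1.1, Sum.inl (LimitArrow.target M g)),
      NegSeq.cons (M.tau [g.1.1 0] (g.1.2 0)) g.1.2), fun k => by
        refine ⟨rfl, ?_⟩
        show M.tau [g.1.1 k] (g.1.2 k) * 1 = 1 * _
        rw [mul_one, one_mul]
        cases k with
        | zero => rfl
        | succ k => exact (g.2.1 k).symm, NegSeq.finite_range_cons _ g.2.2⟩) <|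
  Sum.elim (fun p => ⟨((Sum.inl p.1.1.1, Sum.inr p.1.1.2), p.1.2), p.2⟩) <|
  Sum.elim (fun p => ⟨((Sum.inr p.1.1.2, Sum.inl p.1.1.1), fun k => (p.1.2 k)⁻¹), p.2.inv⟩)
  fun g => ⟨((Sum.inr g.1.1, Sum.inr (LimitArrow.target M' g)),
      fun k => D.conj.symm (NegSeq.cons (M'.tau [g.1.1 0] (g.1.2 0)) g.1.2 k)), fun k => by
        refine D.step_inr_inr.2 ⟨?_, ?_⟩
        · rw [MulEquiv.apply_symm_apply]
          rfl
        · rw [MulEquiv.apply_symm_apply, MulEquiv.apply_symm_apply, mul_one, one_mul]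
          cases k with
          | zero => rfl
          | succ k => exact (g.2.1 k).symm,
      ((NegSeq.finite_range_cons _ g.2.2).image D.conj.symm).subset
        (Set.range_subset_iff.2 fun k => ⟨_, ⟨k, rfl⟩, rfl⟩)⟩

theorem continuous_toArrow : Continuous D.toArrow := by
  refine continuous_sum_dom.2 ⟨?_, continuous_sum_dom.2 ⟨?_, continuous_sum_dom.2 ⟨?_, ?_⟩⟩⟩
  · refine D.codedSpace.continuous_arrow.2 ⟨continuous_inl.comp M.limitSpace.continuous_src,
      continuous_inl.comp M.limitSpace.continuous_tgt, fun k => ?_⟩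
    cases k with
    | zero =>
      exact locallyConstant_map₂ (LimitArrow.locallyConstant_fst 0)
        (LimitArrow.locallyConstant_snd 0) fun a g => M.tau [a] g
    | succ k => exact LimitArrow.locallyConstant_snd k
  · exact D.codedSpace.continuous_arrow.2
      ⟨continuous_inl.comp (continuous_fst.comp (continuous_fst.comp continuous_subtype_val)),
      continuous_inr.comp (continuous_snd.comp (continuous_fst.comp continuous_subtype_val)),
      D.continuous_bitorsor_snd⟩
  · exact D.codedSpace.continuous_arrow.2
      ⟨continuous_inr.comp (continuous_snd.comp (continuous_fst.comp continuous_subtype_val)),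
      continuous_inl.comp (continuous_fst.comp (continuous_fst.comp continuous_subtype_val)),
      fun k => (D.continuous_bitorsor_snd k).comp fun g => g⁻¹⟩
  · refine D.codedSpace.continuous_arrow.2 ⟨continuous_inr.comp M'.limitSpace.continuous_src,
      continuous_inr.comp M'.limitSpace.continuous_tgt, fun k => ?_⟩
    cases k with
    | zero =>
      exact locallyConstant_map₂ (LimitArrow.locallyConstant_fst 0)
        (LimitArrow.locallyConstant_snd 0) fun a g => D.conj.symm (M'.tau [a] g)
    | succ k => exact (LimitArrow.locallyConstant_snd k).comp D.conj.symm

theorem toArrow_injective : Function.Injective D.toArrow := by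
  intro s t h
  have h1 : (D.toArrow s).1.1.1 = (D.toArrow t).1.1.1 := by rw [h]
  have h2 : (D.toArrow s).1.1.2 = (D.toArrow t).1.1.2 := by rw [h]
  have h3 : ∀ k, (D.toArrow s).1.2 k = (D.toArrow t).1.2 k := fun k => by rw [h]
  rcases s with s | s | s | s <;> rcases t with t | t | t | t <;>
    first
    | exact absurd h1 Sum.inl_ne_inr
    | exact absurd h1 Sum.inr_ne_inl
    | exact absurd h2 Sum.inl_ne_inr
    | exact absurd h2 Sum.inr_ne_inl
    | skip
  · exact congrArg Sum.inl (Subtype.ext (Prod.ext (Sum.inl_injective h1)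
      (funext fun k => h3 (k + 1))))
  · exact congrArg (Sum.inr ∘ Sum.inl) (Subtype.ext (Prod.ext (Prod.ext (Sum.inl_injective h1)
      (Sum.inr_injective h2)) (funext h3)))
  · exact congrArg (Sum.inr ∘ Sum.inr ∘ Sum.inl) (Subtype.ext (Prod.ext
      (Prod.ext (Sum.inl_injective h2) (Sum.inr_injective h1))
      (funext fun k => inv_injective (h3 k))))
  · exact congrArg (Sum.inr ∘ Sum.inr ∘ Sum.inr) (Subtype.ext (Prod.ext (Sum.inr_injective h1)
      (funext fun k => D.conj.symm.injective (h3 (k + 1)))))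

theorem toArrow_surjective : Function.Surjective D.toArrow := by
  rintro ⟨⟨⟨x | x, y | y⟩, γ⟩, h⟩
  · have hk : ∀ k, γ k = M.tau [x k] (γ (k + 1)) := fun k => by
      simpa [codedSpace, Step] using (h.1 k).2.symm
    refine ⟨Sum.inl ⟨(x, γ.shift), fun k => hk (k + 1),
      h.2.subset (Set.range_subset_iff.2 fun k => ⟨k + 1, rfl⟩)⟩,
      CodedSpace.Arrow.ext _ rfl ?_ fun k => ?_⟩
    · exact congrArg Sum.inl (funext fun k => (h.1 k).1)
    · cases k with
      | zero => exact (hk 0).symm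
      | succ k => rfl
  · exact ⟨Sum.inr (Sum.inl ⟨((x, y), γ), h⟩), rfl⟩
  · refine ⟨Sum.inr (Sum.inr (Sum.inl ⟨((y, x), fun k => (γ k)⁻¹), h.inv⟩)),
      CodedSpace.Arrow.ext _ rfl rfl fun k => inv_inv _⟩
  · have hs := fun k => D.step_inr_inr.1 (h.1 k)
    have hk : ∀ k, D.conj (γ k) = M'.tau [x k] (D.conj (γ (k + 1))) := fun k => by
      simpa using (hs k).2.symm
    refine ⟨Sum.inr (Sum.inr (Sum.inr ⟨(x, fun k => D.conj (γ (k + 1))), fun k => hk (k + 1),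
      (h.2.image D.conj).subset (Set.range_subset_iff.2 fun k => ⟨_, ⟨k + 1, rfl⟩, rfl⟩)⟩)),
      CodedSpace.Arrow.ext _ rfl ?_ fun k => ?_⟩
    · exact congrArg Sum.inr (funext fun k => (hs k).1)
    · cases k with
      | zero =>
        show D.conj.symm (M'.tau [x 0] (D.conj (γ 1))) = γ 0
        rw [← hk 0, MulEquiv.symm_apply_apply]
      | succ k => exact D.conj.symm_apply_apply _

/-- The group elements which compare the sections of the tree isomorphism with itself. -/
def sections : Set M.group :=
  {g | ∃ v, wordSection (⇑D.map) v = ⇑D.map ∘ ⇑(g : Equiv.Perm (List A))}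

theorem finite_sections : D.sections.Finite := by
  refine Set.Finite.of_finite_image (f := fun g : M.group => ⇑D.map ∘ ⇑(g : Equiv.Perm (List A)))
    (D.finite_section.subset ?_) ?_
  · rintro _ ⟨g, ⟨v, hv⟩, rfl⟩
    exact ⟨v, hv⟩
  · intro g _ h _ e
    exact M.group_ext fun w => D.map.injective (congrFun e w)

theorem one_mem_sections : 1 ∈ D.sections := ⟨[], by funext w; simp [wordSection]⟩

theorem wordSection_of_step {a : A} {b : A'} {γ δ : M.group} (h : M.Step (a, 1) (D.lam b) γ δ) :
    ⇑D.map ∘ ⇑(δ : Equiv.Perm (List A)) =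
      wordSection (⇑D.map ∘ ⇑(γ : Equiv.Perm (List A))) [a] := by
  funext w
  have := D.step_inl_inr.1 h w
  simp [wordSection, this]

theorem wordSection_append {B C : Type*} (f : List B → List C) (v w : List B) :
    wordSection f (v ++ w) = wordSection (wordSection f v) w := by
  funext u
  simp [wordSection]

theorem sections_of_step {a : A} {b : A'} {γ δ : M.group} (h : M.Step (a, 1) (D.lam b) γ δ)
    (hγ : γ ∈ D.sections) : δ ∈ D.sections := by
  obtain ⟨v, hv⟩ := hγ
  exact ⟨v ++ [a], by rw [wordSection_append, hv, D.wordSection_of_step h]⟩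

theorem exists_step_right (a : A) (γ : M.group) : ∃ b δ, M.Step (a, 1) (D.lam b) γ δ :=
  ⟨D.letter (M.sigma a γ), (D.lam (D.letter (M.sigma a γ))).2⁻¹ * (M.tau [a] γ * 1),
    by simp [lam], by rw [mul_inv_cancel_left]⟩

theorem exists_step_left (b : A') (γ : M.group) : ∃ a δ, M.Step (a, 1) (D.lam b) γ δ :=
  ⟨M.sigma (D.lam b).1 γ⁻¹, (D.lam b).2⁻¹ * (M.tau [M.sigma (D.lam b).1 γ⁻¹] γ * 1),
    M.sigma_sigma_inv _ _, by rw [mul_inv_cancel_left]⟩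

theorem Bitorsor.mem_sections_mul (p : D.Bitorsor) (k n : ℕ) :
    ∃ v : List A, v.length = n ∧ ∃ s ∈ D.sections, p.1.2 k = s * M.tau v (p.1.2 (k + n)) := by
  have h : ∃ v : List A, v.length = n ∧ ⇑D.map ∘ ⇑(p.1.2 k : Equiv.Perm (List A)) =
      wordSection (⇑D.map ∘ ⇑(p.1.2 (k + n) : Equiv.Perm (List A))) v := by
    induction n with
    | zero => exact ⟨[], rfl, by funext w; simp [wordSection]⟩
    | succ n ih =>
      obtain ⟨v, hv, e⟩ := ih
      refine ⟨p.1.1.1 (k + n) :: v, by simp [hv], ?_⟩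
      have h1 := D.wordSection_of_step (p.2.1 (k + n))
      rw [e, h1, ← wordSection_append]
      rfl
  obtain ⟨v, hv, e⟩ := h
  refine ⟨v, hv, p.1.2 k * (M.tau v (p.1.2 (k + n)))⁻¹, ⟨(p.1.2 (k + n) : Equiv.Perm _) v, ?_⟩,
    by simp⟩
  rw [wordSection_comp D.isTreeMap (M.group_isTreeMap _), ← coe_tau] at e
  funext w
  have h1 := congrFun e ((((M.tau v (p.1.2 (k + n)))⁻¹ : M.group) : Equiv.Perm (List A)) w)
  simpa using h1.symm

end TreeConj
end Transducer

namespace Transducer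
variable {A : Type u} {Q : Type w} {A' : Type v} {Q' : Type x}
namespace TreeConj

variable {M : Automaton A Q} {M' : Automaton A' Q'} (D : TreeConj M M')

theorem exists_finite_bitorsor [Finite A] (hM : M.Contracting) :
    ∃ N : Set M.group, N.Finite ∧ ∀ (p : D.Bitorsor) (k : ℕ), p.1.2 k ∈ N := by
  obtain ⟨N, hN, h⟩ := hM.exists_finite
  refine ⟨Set.image2 (fun s g => s * g) D.sections N, D.finite_sections.image2 _ hN,
    fun p k => ?_⟩
  choose n hn using h
  obtain ⟨m, hm⟩ := (p.2.2.image n).bddAbove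
  obtain ⟨v, hv, s, hs, e⟩ := Bitorsor.mem_sections_mul D p k m
  exact ⟨s, hs, _, hn _ v ((hm ⟨_, ⟨_, rfl⟩, rfl⟩).trans hv.ge), e.symm⟩

/-- The triples of sequences which satisfy one of the conditions defining the bitorsor. -/
def stepSet (k : ℕ) : Set ((NegSeq A × NegSeq A') × NegSeq M.group) :=
  {t | M.Step (t.1.1 k, 1) (D.lam (t.1.2 k)) (t.2 (k + 1)) (t.2 k)}

theorem isClosed_stepSet (k : ℕ) : IsClosed (D.stepSet k) := by
  have h1 := NegSeq.continuous_iff.1 (continuous_fst.comp continuous_fst :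
    Continuous fun t : (NegSeq A × NegSeq A') × NegSeq M.group => t.1.1) k
  have h2 := NegSeq.continuous_iff.1 (continuous_snd.comp continuous_fst :
    Continuous fun t : (NegSeq A × NegSeq A') × NegSeq M.group => t.1.2) k
  have h3 := NegSeq.continuous_iff.1 (continuous_snd :
    Continuous fun t : (NegSeq A × NegSeq A') × NegSeq M.group => t.2)
  exact ((h1.prodMk (h2.prodMk ((h3 (k + 1)).prodMk (h3 k)))).isClopen_setOf
    fun q => M.Step (q.1, 1) (D.lam q.2.1) q.2.2.1 q.2.2.2).isClosed

variable [Finite A] [Finite A']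

theorem isCompact_triples {N : Set M.group} (hN : N.Finite) :
    IsCompact {t : (NegSeq A × NegSeq A') × NegSeq M.group | ∀ k, t.2 k ∈ N} := by
  have h := (isCompact_univ (X := NegSeq A × NegSeq A')).prod (NegSeq.isCompact_of_finite hN)
  refine h.of_isClosed_subset ?_ fun t ht => ⟨trivial, ht⟩
  have e : {t : (NegSeq A × NegSeq A') × NegSeq M.group | ∀ k, t.2 k ∈ N} =
      Prod.snd ⁻¹' {φ : NegSeq M.group | ∀ k, φ k ∈ N} := rfl
  rw [e]
  exact (NegSeq.isCompact_of_finite hN).isClosed.preimage continuous_snd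

theorem compactSpace_bitorsor (hM : M.Contracting) : CompactSpace D.Bitorsor := by
  obtain ⟨N, hN, h⟩ := D.exists_finite_bitorsor hM
  suffices hc : IsCompact {t : (NegSeq A × NegSeq A') × NegSeq M.group |
      D.codedSpace.Rel (Sum.inl t.1.1) (Sum.inr t.1.2) t.2} from isCompact_iff_compactSpace.1 hc
  have e : {t : (NegSeq A × NegSeq A') × NegSeq M.group |
      D.codedSpace.Rel (Sum.inl t.1.1) (Sum.inr t.1.2) t.2} =
      {t | ∀ k, t.2 k ∈ N} ∩ ⋂ k, D.stepSet k := by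
    ext t
    constructor
    · exact fun ht => ⟨fun k => h ⟨t, ht⟩ k, Set.mem_iInter.2 ht.1⟩
    · exact fun ht => ⟨Set.mem_iInter.1 ht.2, hN.subset (Set.range_subset_iff.2 ht.1)⟩
  rw [e]
  exact (isCompact_triples hN).inter_right (isClosed_iInter D.isClosed_stepSet)

theorem exists_bitorsor {K : Set ((NegSeq A × NegSeq A') × NegSeq M.group)} (hK : IsClosed K)
    (h : ∀ n, ∃ t ∈ K, (∀ k, t.2 k ∈ D.sections) ∧ ∀ k < n, t ∈ D.stepSet k) :
    ∃ p : D.Bitorsor, p.1 ∈ K := by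
  let E : ℕ → Set ((NegSeq A × NegSeq A') × NegSeq M.group) := fun n =>
    {t | ∀ k, t.2 k ∈ D.sections} ∩ (K ∩ ⋂ k, ⋂ (_ : k < n), D.stepSet k)
  have hcl : ∀ n, IsClosed (K ∩ ⋂ k, ⋂ (_ : k < n), D.stepSet k) := fun n =>
    hK.inter (isClosed_iInter fun k => isClosed_iInter fun _ => D.isClosed_stepSet k)
  have hcomp := isCompact_triples (A := A) (A' := A') D.finite_sections
  obtain ⟨t, ht⟩ := IsCompact.nonempty_iInter_of_sequence_nonempty_isCompact_isClosed E
    (fun n t ht => ⟨ht.1, ht.2.1, Set.mem_iInter₂.2 fun k hk =>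
      Set.mem_iInter₂.1 ht.2.2 k (Nat.lt_succ_of_lt hk)⟩)
    (fun n => let ⟨t, h1, h2, h3⟩ := h n; ⟨t, h2, h1, Set.mem_iInter₂.2 h3⟩)
    (hcomp.inter_right (hcl 0)) fun n => hcomp.isClosed.inter (hcl n)
  rw [Set.mem_iInter] at ht
  exact ⟨⟨t, fun k => Set.mem_iInter₂.1 (ht (k + 1)).2.2 k (Nat.lt_succ_self k),
    D.finite_sections.subset (Set.range_subset_iff.2 (ht 0).1)⟩, (ht 0).2.1⟩

theorem exists_src (α : NegSeq A) : ∃ p : D.Bitorsor, p.1.1.1 = α := by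
  refine D.exists_bitorsor (K := {t | t.1.1 = α})
    (isClosed_singleton.preimage (continuous_fst.comp continuous_fst)) fun n => ?_
  induction n generalizing α with
  | zero => exact ⟨((α, fun _ => D.letter (α 0)), fun _ => 1), rfl, fun _ => D.one_mem_sections,
      fun k hk => absurd hk (Nat.not_lt_zero k)⟩
  | succ n ih =>
    obtain ⟨⟨⟨α', β⟩, γ⟩, h1, h2, h3⟩ := ih α.shift
    obtain ⟨b, δ, h⟩ := D.exists_step_right (α 0) (γ 0)
    have h1 : α' = α.shift := h1
    subst h1
    refine ⟨((α, NegSeq.cons b β), NegSeq.cons δ γ), rfl, fun k => ?_, fun k hk => ?_⟩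
    · cases k with
      | zero => exact D.sections_of_step h (h2 0)
      | succ k => exact h2 k
    · cases k with
      | zero => exact h
      | succ k => exact h3 k (Nat.lt_of_succ_lt_succ hk)

theorem exists_tgt (β : NegSeq A') : ∃ p : D.Bitorsor, p.1.1.2 = β := by
  refine D.exists_bitorsor (K := {t | t.1.2 = β})
    (isClosed_singleton.preimage (continuous_snd.comp continuous_fst)) fun n => ?_
  induction n generalizing β with
  | zero => exact ⟨((fun _ => D.letter.symm (β 0), β), fun _ => 1), rfl,
      fun _ => D.one_mem_sections, fun k hk => absurd hk (Nat.not_lt_zero k)⟩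
  | succ n ih =>
    obtain ⟨⟨⟨α, β'⟩, γ⟩, h1, h2, h3⟩ := ih β.shift
    obtain ⟨a, δ, h⟩ := D.exists_step_left (β 0) (γ 0)
    have h1 : β' = β.shift := h1
    subst h1
    refine ⟨((NegSeq.cons a α, β), NegSeq.cons δ γ), rfl, fun k => ?_, fun k hk => ?_⟩
    · cases k with
      | zero => exact D.sections_of_step h (h2 0)
      | succ k => exact h2 k
    · cases k with
      | zero => exact h
      | succ k => exact h3 k (Nat.lt_of_succ_lt_succ hk)

/-- The arrows of the linking groupoid are those of the groupoid of a coded space. -/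
noncomputable def arrowHomeomorph (hM : M.Contracting) (hM' : M'.Contracting) :
    (M.LimitArrow ⊕ D.Bitorsor ⊕ D.Bitorsor ⊕ M'.LimitArrow) ≃ₜ D.codedSpace.Arrow :=
  have := hM.compactSpace_limitArrow
  have := hM'.compactSpace_limitArrow
  have := D.compactSpace_bitorsor hM
  have : T2Space D.codedSpace.Arrow := inferInstanceAs (T2Space {_t :
    ((NegSeq A ⊕ NegSeq A') × (NegSeq A ⊕ NegSeq A')) × NegSeq M.group // _})
  Continuous.homeoOfEquivCompactToT2
    (f := Equiv.ofBijective D.toArrow ⟨D.toArrow_injective, D.toArrow_surjective⟩)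
    D.continuous_toArrow

/-- The linking groupoid of the limit spaces of two equivalent automata. -/
noncomputable def linking (hM : M.Contracting) (hM' : M'.Contracting) :
    TopGroupoid.Linking M.limitSpace M'.limitSpace D.Bitorsor where
  srcP p := p.1.1.1
  tgtP p := p.1.1.2
  total := D.codedSpace.groupoid.comap (D.arrowHomeomorph hM hM')
  src_eq := funext fun t => by rcases t with t | t | t | t <;> rfl
  tgt_eq := funext fun t => by rcases t with t | t | t | t <;> rfl
  mul_left g h e e' := by
    refine (Homeomorph.symm_apply_eq _).2 (CodedSpace.Arrow.ext _ rfl ?_ fun k => ?_)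
    · exact congrArg Sum.inl (M.limitSpace.tgt_mul g h e).symm
    · cases k with
      | zero =>
        have e0 : M.sigma (g.1.1 0) (g.1.2 0) = h.1.1 0 := congrFun e 0
        show M.tau [h.1.1 0] (h.1.2 0) * M.tau [g.1.1 0] (g.1.2 0) =
          M.tau [g.1.1 0] (h.1.2 0 * g.1.2 0)
        rw [tau_mul, e0]
      | succ k => rfl
  mul_right g h e e' := by
    refine (Homeomorph.symm_apply_eq _).2 (CodedSpace.Arrow.ext _ rfl ?_ fun k => ?_)
    · exact congrArg Sum.inr (M'.limitSpace.tgt_mul g h e).symm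
    · cases k with
      | zero =>
        have e0 : M'.sigma (g.1.1 0) (g.1.2 0) = h.1.1 0 := congrFun e 0
        show D.conj.symm (M'.tau [h.1.1 0] (h.1.2 0)) * D.conj.symm (M'.tau [g.1.1 0] (g.1.2 0)) =
          D.conj.symm (M'.tau [g.1.1 0] (h.1.2 0 * g.1.2 0))
        rw [tau_mul, e0, map_mul]
      | succ k => exact (map_mul D.conj.symm _ _).symm

/-- The shift of the linking groupoid. -/
noncomputable def linkingShift (hM : M.Contracting) (hM' : M'.Contracting) :
    TopGroupoid.SelfCovering (D.linking hM hM').total :=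
  TopGroupoid.SelfCovering.comap ⟨D.codedSpace.shiftHom, D.codedSpace.shiftHom_isCovering⟩
    (D.arrowHomeomorph hM hM')

end TreeConj
end Transducer

namespace TopGroupoid

variable {X G : Type u} [TopologicalSpace X] [TopologicalSpace G]
  {X' G' : Type v} [TopologicalSpace X'] [TopologicalSpace G']
  {𝒢 : TopGroupoid X G} {𝒢' : TopGroupoid X' G'}
  {P : Type (max u v)} [TopologicalSpace P] (L : Linking 𝒢 𝒢' P)

namespace Linking

theorem exists_inl {t : G ⊕ P ⊕ P ⊕ G'} {x y : X} (hs : L.total.src t = Sum.inl x)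
    (ht : L.total.tgt t = Sum.inl y) : ∃ g, Sum.inl g = t := by
  rw [L.src_eq] at hs
  rw [L.tgt_eq] at ht
  rcases t with t | t | t | t
  · exact ⟨t, rfl⟩
  · exact nomatch ht
  · exact nomatch hs
  · exact nomatch hs

theorem exists_inr_inl {t : G ⊕ P ⊕ P ⊕ G'} {x : X} {y : X'} (hs : L.total.src t = Sum.inl x)
    (ht : L.total.tgt t = Sum.inr y) : ∃ p, Sum.inr (Sum.inl p) = t := by
  rw [L.src_eq] at hs
  rw [L.tgt_eq] at ht
  rcases t with t | t | t | t
  · exact nomatch ht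
  · exact ⟨t, rfl⟩
  · exact nomatch hs
  · exact nomatch hs

theorem exists_inr_inr_inl {t : G ⊕ P ⊕ P ⊕ G'} {x : X} {y : X'}
    (hs : L.total.src t = Sum.inr y) (ht : L.total.tgt t = Sum.inl x) :
    ∃ p, Sum.inr (Sum.inr (Sum.inl p)) = t := by
  rw [L.src_eq] at hs
  rw [L.tgt_eq] at ht
  rcases t with t | t | t | t
  · exact nomatch hs
  · exact nomatch hs
  · exact ⟨t, rfl⟩
  · exact nomatch ht

theorem exists_inr_inr_inr {t : G ⊕ P ⊕ P ⊕ G'} {x y : X'} (hs : L.total.src t = Sum.inr x)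
    (ht : L.total.tgt t = Sum.inr y) : ∃ g, Sum.inr (Sum.inr (Sum.inr g)) = t := by
  rw [L.src_eq] at hs
  rw [L.tgt_eq] at ht
  rcases t with t | t | t | t
  · exact nomatch hs
  · exact nomatch hs
  · exact nomatch ht
  · exact ⟨t, rfl⟩

theorem src_inl (g : G) : L.total.src (Sum.inl g) = Sum.inl (𝒢.src g) := by rw [L.src_eq]; rfl
theorem tgt_inl (g : G) : L.total.tgt (Sum.inl g) = Sum.inl (𝒢.tgt g) := by rw [L.tgt_eq]; rfl
theorem src_inr_inl (p : P) : L.total.src (Sum.inr (Sum.inl p)) = Sum.inl (L.srcP p) := by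
  rw [L.src_eq]; rfl
theorem tgt_inr_inl (p : P) : L.total.tgt (Sum.inr (Sum.inl p)) = Sum.inr (L.tgtP p) := by
  rw [L.tgt_eq]; rfl
theorem src_inr_inr_inl (p : P) :
    L.total.src (Sum.inr (Sum.inr (Sum.inl p))) = Sum.inr (L.tgtP p) := by
  rw [L.src_eq]; rfl
theorem tgt_inr_inr_inl (p : P) :
    L.total.tgt (Sum.inr (Sum.inr (Sum.inl p))) = Sum.inl (L.srcP p) := by
  rw [L.tgt_eq]; rfl
theorem src_inr_inr_inr (g : G') :
    L.total.src (Sum.inr (Sum.inr (Sum.inr g))) = Sum.inr (𝒢'.src g) := by rw [L.src_eq]; rfl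
theorem tgt_inr_inr_inr (g : G') :
    L.total.tgt (Sum.inr (Sum.inr (Sum.inr g))) = Sum.inr (𝒢'.tgt g) := by rw [L.tgt_eq]; rfl

end Linking

section Division

variable (𝒢) in
theorem mul_inv_mul (g h : G) (e : 𝒢.src g = 𝒢.src h) :
    𝒢.mul g (𝒢.mul (𝒢.inv g) h ((𝒢.tgt_inv g).trans e))
      ((𝒢.src_inv g).symm.trans (𝒢.src_mul _ _ _).symm) = h := by
  have h1 := 𝒢.mul_assoc g (𝒢.inv g) h (𝒢.src_inv g).symm ((𝒢.tgt_inv g).trans e)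
  rw [← h1]
  have h2 : ∀ (k : G) (hk : k = 𝒢.one (𝒢.src h)) (e' : 𝒢.tgt k = 𝒢.src h), 𝒢.mul k h e' = h := by
    rintro k rfl e'
    exact 𝒢.one_mul h
  exact h2 _ (by rw [𝒢.mul_inv, e]) _

variable (𝒢) in
theorem mul_mul_inv (g h : G) (e : 𝒢.tgt g = 𝒢.tgt h) :
    𝒢.mul (𝒢.mul h (𝒢.inv g) (e.symm.trans (𝒢.src_inv g).symm)) g
      ((𝒢.tgt_mul _ _ _).trans (𝒢.tgt_inv g)) = h := by
  rw [𝒢.mul_assoc h (𝒢.inv g) g (e.symm.trans (𝒢.src_inv g).symm) (𝒢.tgt_inv g)]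
  have h2 : ∀ (k : G) (hk : k = 𝒢.one (𝒢.tgt h)) (e' : 𝒢.tgt h = 𝒢.src k), 𝒢.mul h k e' = h := by
    rintro k rfl e'
    exact 𝒢.mul_one h
  exact h2 _ (by rw [𝒢.inv_mul, e]) _

end Division

namespace Linking

theorem relRight_of_srcP_eq {p q : P} (h : L.srcP p = L.srcP q) : L.RelRight p q := by
  have e : L.total.src (Sum.inr (Sum.inl p)) = L.total.src (Sum.inr (Sum.inl q)) := by
    rw [L.src_inr_inl, L.src_inr_inl, h]
  obtain ⟨k, hk⟩ := L.exists_inr_inr_inr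
    (t := L.total.mul (L.total.inv (Sum.inr (Sum.inl p))) (Sum.inr (Sum.inl q))
      ((L.total.tgt_inv _).trans e))
    ((L.total.src_mul _ _ _).trans ((L.total.src_inv _).trans (L.tgt_inr_inl p)))
    ((L.total.tgt_mul _ _ _).trans (L.tgt_inr_inl q))
  have h1 := L.total.mul_inv_mul _ _ e
  simp only [← hk] at h1
  exact ⟨k, _, h1⟩

theorem relLeft_of_tgtP_eq {p q : P} (h : L.tgtP p = L.tgtP q) : L.RelLeft p q := by
  have e : L.total.tgt (Sum.inr (Sum.inl p)) = L.total.tgt (Sum.inr (Sum.inl q)) := by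
    rw [L.tgt_inr_inl, L.tgt_inr_inl, h]
  obtain ⟨k, hk⟩ := L.exists_inl
    (t := L.total.mul (Sum.inr (Sum.inl q)) (L.total.inv (Sum.inr (Sum.inl p)))
      (e.symm.trans (L.total.src_inv _).symm))
    ((L.total.src_mul _ _ _).trans (L.src_inr_inl q))
    ((L.total.tgt_mul _ _ _).trans ((L.total.tgt_inv _).trans (L.src_inr_inl p)))
  have h1 := L.total.mul_mul_inv _ _ e
  simp only [← hk] at h1
  exact ⟨k, _, h1⟩

theorem isMorita_of_compactSpace [CompactSpace P] [T2Space X] [T2Space X']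
    (hs : Continuous L.srcP) (ht : Continuous L.tgtP) (hs' : Function.Surjective L.srcP)
    (ht' : Function.Surjective L.tgtP) : L.IsMorita := by
  constructor
  · refine isHomeomorph_iff_continuous_bijective.2 ⟨continuous_quot_lift _ hs, ?_, ?_⟩
    · rintro ⟨p⟩ ⟨q⟩ h
      exact Quot.sound (L.relRight_of_srcP_eq h)
    · exact fun x => let ⟨p, hp⟩ := hs' x; ⟨Quot.mk _ p, hp⟩
  · refine isHomeomorph_iff_continuous_bijective.2 ⟨continuous_quot_lift _ ht, ?_, ?_⟩
    · rintro ⟨p⟩ ⟨q⟩ h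
      exact Quot.sound (L.relLeft_of_tgtP_eq h)
    · exact fun x => let ⟨p, hp⟩ := ht' x; ⟨Quot.mk _ p, hp⟩

end Linking

end TopGroupoid

namespace Transducer

variable {A : Type u} {Q : Type w} {A' : Type v} {Q' : Type x}
  {M : Automaton A Q} {M' : Automaton A' Q'}

theorem TreeConj.moritaEquivalent [Finite A] [Finite A'] (D : TreeConj M M') (hM : M.Contracting)
    (hM' : M'.Contracting) : TopGroupoid.MoritaEquivalent M.limitShift M'.limitShift := by
  have := D.compactSpace_bitorsor hM
  refine ⟨D.Bitorsor, inferInstance, D.linking hM hM', D.linkingShift hM hM', ?_, fun _ => rfl,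
    fun _ => rfl, fun g => ?_, fun g => ?_⟩
  · exact (D.linking hM hM').isMorita_of_compactSpace
      (continuous_fst.comp (continuous_fst.comp continuous_subtype_val))
      (continuous_snd.comp (continuous_fst.comp continuous_subtype_val)) D.exists_src D.exists_tgt
  · refine (Homeomorph.symm_apply_eq _).2 (CodedSpace.Arrow.ext _ rfl rfl fun k => ?_)
    cases k with
    | zero => exact g.2.1 0
    | succ k => rfl
  · refine (Homeomorph.symm_apply_eq _).2 (CodedSpace.Arrow.ext _ rfl rfl fun k => ?_)
    cases k with
    | zero => exact congrArg D.conj.symm (g.2.1 0)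
    | succ k => rfl

end Transducer

namespace TopGroupoid.SelfCovering

variable {X G : Type u} [TopologicalSpace X] [TopologicalSpace G] {𝒢 : TopGroupoid X G}
  (F : SelfCovering 𝒢)

/-- The lift of an arrow to a given source. -/
noncomputable def lift (p : {p : X × G // F.obj p.1 = 𝒢.src p.2}) : G :=
  F.isCovering.2.2.homeomorph.symm p

theorem lift_spec (p : {p : X × G // F.obj p.1 = 𝒢.src p.2}) :
    𝒢.src (F.lift p) = p.1.1 ∧ F.arr (F.lift p) = p.1.2 := by
  have h := congrArg Subtype.val (F.isCovering.2.2.homeomorph.apply_symm_apply p)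
  exact ⟨congrArg Prod.fst h, congrArg Prod.snd h⟩

theorem continuous_lift : Continuous F.lift := F.isCovering.2.2.homeomorph.symm.continuous

theorem ext_lift {g h : G} (h1 : 𝒢.src g = 𝒢.src h) (h2 : F.arr g = F.arr h) : g = h :=
  F.isCovering.2.2.injective (Subtype.ext (Prod.ext h1 h2))

end TopGroupoid.SelfCovering

namespace Transducer

variable {A : Type u} {Q : Type w} {M : Automaton A Q}

namespace LimitArrow

/-- The action of an arrow of the limit space on the iterated preimages of its source. -/
noncomputable def cocycle (g : M.LimitArrow) : M.group := M.tau [g.1.1 0] (g.1.2 0)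

theorem locallyConstant_cocycle :
    IsLocallyConstant (cocycle : M.LimitArrow → M.group) :=
  locallyConstant_map₂ (locallyConstant_fst 0) (locallyConstant_snd 0) fun a g => M.tau [a] g

/-- The lift of an arrow by the shift. -/
noncomputable def lift (a : A) (g : M.LimitArrow) : M.LimitArrow :=
  ⟨(NegSeq.cons a g.1.1, NegSeq.cons g.cocycle g.1.2), fun k => by
    cases k with
    | zero => rfl
    | succ k => exact g.2.1 k, NegSeq.finite_range_cons _ g.2.2⟩

theorem cocycle_lift (a : A) (g : M.LimitArrow) : (lift a g).cocycle = M.tau [a] g.cocycle := rfl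

theorem src_lift (a : A) (g : M.LimitArrow) :
    M.limitSpace.src (lift a g) = NegSeq.cons a (M.limitSpace.src g) := rfl

theorem tgt_lift (a : A) (g : M.LimitArrow) : M.limitSpace.tgt (lift a g) =
    NegSeq.cons (M.sigma a g.cocycle) (M.limitSpace.tgt g) := by
  funext k
  cases k <;> rfl

theorem shift_lift (a : A) (g : M.LimitArrow) : M.limitShift.arr (lift a g) = g := rfl

end LimitArrow

variable {A' : Type v} {Q' : Type x} {M' : Automaton A' Q'}

open TopGroupoid

/-- The limit spaces of `M` and `M'` are disjoint parts of a groupoid with a self-covering, and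
`P` is the space of arrows from the first to the second one. -/
structure IsCorner {Y T : Type z} [TopologicalSpace Y] [TopologicalSpace T] {𝒯 : TopGroupoid Y T}
    (F : 𝒯.SelfCovering) (i : NegSeq A → Y) (i' : NegSeq A' → Y) (j : M.LimitArrow → T)
    (j' : M'.LimitArrow → T) {P : Type*} [TopologicalSpace P] (k : P → T)
    (s : P → NegSeq A) (t : P → NegSeq A') : Prop where
  emb_i : IsEmbedding i
  emb_i' : IsEmbedding i'
  emb_j' : IsEmbedding j'
  emb_k : IsEmbedding k
  src_j : ∀ g, 𝒯.src (j g) = i (M.limitSpace.src g)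
  tgt_j : ∀ g, 𝒯.tgt (j g) = i (M.limitSpace.tgt g)
  src_j' : ∀ g, 𝒯.src (j' g) = i' (M'.limitSpace.src g)
  tgt_j' : ∀ g, 𝒯.tgt (j' g) = i' (M'.limitSpace.tgt g)
  src_k : ∀ p, 𝒯.src (k p) = i (s p)
  tgt_k : ∀ p, 𝒯.tgt (k p) = i' (t p)
  exists_k : ∀ x a b, 𝒯.src x = i a → 𝒯.tgt x = i' b → ∃ p, k p = x
  exists_j' : ∀ x a b, 𝒯.src x = i' a → 𝒯.tgt x = i' b → ∃ h, j' h = x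
  obj_i : ∀ x, F.obj (i x) = i x.shift
  obj_i' : ∀ x, F.obj (i' x) = i' x.shift
  exists_i' : ∀ y x, F.obj y = i' x → ∃ x', y = i' x'
  arr_j : ∀ g, F.arr (j g) = j (M.limitShift.arr g)
  arr_j' : ∀ g, F.arr (j' g) = j' (M'.limitShift.arr g)
  j'_one : ∀ x, j' (M'.limitSpace.one x) = 𝒯.one (i' x)
  quotient_s : IsQuotientMap s

namespace IsCorner

variable {Y T : Type z} [TopologicalSpace Y] [TopologicalSpace T] {𝒯 : TopGroupoid Y T}
  {F : 𝒯.SelfCovering} {i : NegSeq A → Y} {i' : NegSeq A' → Y} {j : M.LimitArrow → T}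
  {j' : M'.LimitArrow → T} {P : Type*} [TopologicalSpace P] {k : P → T}
  {s : P → NegSeq A} {t : P → NegSeq A'} (C : IsCorner F i i' j j' k s t)

theorem continuous_s (C : IsCorner F i i' j j' k s t) : Continuous s := C.quotient_s.continuous

theorem continuous_t (C : IsCorner F i i' j j' k s t) : Continuous t := by
  rw [C.emb_i'.continuous_iff]
  exact (𝒯.continuous_tgt.comp C.emb_k.continuous).congr C.tgt_k

theorem exists_lift (C : IsCorner F i i' j j' k s t) (a : A) (p : P) :
    ∃ q, s q = NegSeq.cons a (s p) ∧ F.arr (k q) = k p := by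
  have h := F.lift_spec ⟨(i (NegSeq.cons a (s p)), k p), by
    rw [C.obj_i, C.src_k, NegSeq.shift_cons]⟩
  obtain ⟨y, hy⟩ := C.exists_i' (𝒯.tgt (F.lift _)) (t p)
    ((F.map_tgt _).trans ((congrArg 𝒯.tgt h.2).trans (C.tgt_k p)))
  obtain ⟨q, hq⟩ := C.exists_k _ _ _ h.1 hy
  refine ⟨q, C.emb_i.injective ?_, ?_⟩
  · rw [← C.src_k, hq, h.1]
  · rw [hq, h.2]

/-- The lift of an arrow to the preimage of its source given by a letter. -/
noncomputable def lift (a : A) (p : P) : P := (C.exists_lift a p).choose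

theorem s_lift (a : A) (p : P) : s (C.lift a p) = NegSeq.cons a (s p) :=
  (C.exists_lift a p).choose_spec.1

theorem arr_lift (a : A) (p : P) : F.arr (k (C.lift a p)) = k p :=
  (C.exists_lift a p).choose_spec.2

theorem shift_t_lift (a : A) (p : P) : (t (C.lift a p)).shift = t p := by
  apply C.emb_i'.injective
  rw [← C.obj_i', ← C.tgt_k, ← C.tgt_k, F.map_tgt, C.arr_lift]

theorem continuous_lift (a : A) : Continuous (C.lift a) := by
  rw [C.emb_k.continuous_iff]
  have h : ∀ p, F.obj (i (NegSeq.cons a (s p))) = 𝒯.src (k p) := fun p => by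
    rw [C.obj_i, C.src_k, NegSeq.shift_cons]
  have hc : Continuous fun p => F.lift ⟨(i (NegSeq.cons a (s p)), k p), h p⟩ := by
    refine F.continuous_lift.comp (Continuous.subtype_mk (Continuous.prodMk ?_ ?_) _)
    · exact C.emb_i.continuous.comp ((NegSeq.continuous_cons a).comp C.continuous_s)
    · exact C.emb_k.continuous
  refine hc.congr fun p => ?_
  have hs := F.lift_spec ⟨(i (NegSeq.cons a (s p)), k p), h p⟩
  exact F.ext_lift (by rw [hs.1, Function.comp_apply, C.src_k, C.s_lift])
    (by rw [hs.2, Function.comp_apply, C.arr_lift])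

/-- The automaton with states the arrows in `P` which describes their action on the iterated
preimages of their source. -/
noncomputable def transducer : Transducer A A' P where
  out a p := t (C.lift a p) 0
  trans a p := C.lift a p

theorem t_lift (a : A) (p : P) : t (C.lift a p) = NegSeq.cons (C.transducer.out a p) (t p) :=
  NegSeq.eq_cons (C.shift_t_lift a p) rfl

theorem run_cons (a : A) (p : P) (w : List A) : C.transducer.run p (a :: w) =
    C.transducer.out a p :: C.transducer.run (C.lift a p) w := rfl

theorem locallyConstant_out (a : A) : IsLocallyConstant (C.transducer.out a) :=
  (NegSeq.eval 0).comp_continuous (C.continuous_t.comp (C.continuous_lift a))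

theorem mul_congr {g h g' h' : T} (h1 : g = g') (h2 : h = h') (e : 𝒯.tgt g = 𝒯.src h) :
    𝒯.mul g h e = 𝒯.mul g' h' (by rw [← h1, ← h2, e]) := by
  subst h1 h2; rfl

theorem run_act_left (w : List A) (g : M.LimitArrow) (p q : P) (e : 𝒯.tgt (j g) = 𝒯.src (k p))
    (hq : k q = 𝒯.mul (j g) (k p) e) :
    C.transducer.run q w = C.transducer.run p ((g.cocycle : Equiv.Perm (List A)) w) := by
  induction w generalizing g p q with
  | nil => rw [apply_nil]; rfl
  | cons a w ih =>
    have hsp : M.limitSpace.tgt g = s p := C.emb_i.injective (by rw [← C.tgt_j, e, C.src_k])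
    have hsq : s q = M.limitSpace.src g := C.emb_i.injective (by
      rw [← C.src_k, hq, 𝒯.src_mul, C.src_j])
    have e' : 𝒯.tgt (j (LimitArrow.lift a g)) =
        𝒯.src (k (C.lift (M.sigma a g.cocycle) p)) := by
      rw [C.tgt_j, C.src_k, C.s_lift, LimitArrow.tgt_lift, hsp]
    have hl : k (C.lift a q) =
        𝒯.mul (j (LimitArrow.lift a g)) (k (C.lift (M.sigma a g.cocycle) p)) e' := by
      apply F.ext_lift
      · rw [C.src_k, C.s_lift, 𝒯.src_mul, C.src_j, LimitArrow.src_lift, hsq]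
      · rw [C.arr_lift, F.map_mul, hq]
        exact mul_congr (by rw [C.arr_j, LimitArrow.shift_lift]) (C.arr_lift _ _).symm _
    have ht : t (C.lift a q) = t (C.lift (M.sigma a g.cocycle) p) :=
      C.emb_i'.injective (by rw [← C.tgt_k, hl, 𝒯.tgt_mul, C.tgt_k])
    rw [apply_cons, C.run_cons, C.run_cons, ih _ _ _ e' hl, LimitArrow.cocycle_lift]
    exact congrArg (· :: _) (congrFun ht 0)

theorem run_act_right (w : List A) (g : M'.LimitArrow) (p q : P) (e : 𝒯.tgt (k p) = 𝒯.src (j' g))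
    (hq : k q = 𝒯.mul (k p) (j' g) e) :
    C.transducer.run q w = (g.cocycle : Equiv.Perm (List A')) (C.transducer.run p w) := by
  induction w generalizing g p q with
  | nil => exact (M'.apply_nil _).symm
  | cons a w ih =>
    have htp : t p = M'.limitSpace.src g := C.emb_i'.injective (by rw [← C.tgt_k, e, C.src_j'])
    have hsq : s q = s p := C.emb_i.injective (by rw [← C.src_k, hq, 𝒯.src_mul, C.src_k])
    have e' : 𝒯.tgt (k (C.lift a p)) =
        𝒯.src (j' (LimitArrow.lift (C.transducer.out a p) g)) := by
      rw [C.tgt_k, C.src_j', C.t_lift, LimitArrow.src_lift, htp]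
    have hl : k (C.lift a q) =
        𝒯.mul (k (C.lift a p)) (j' (LimitArrow.lift (C.transducer.out a p) g)) e' := by
      apply F.ext_lift
      · rw [C.src_k, C.s_lift, 𝒯.src_mul, C.src_k, C.s_lift, hsq]
      · rw [C.arr_lift, F.map_mul, hq]
        exact mul_congr (C.arr_lift _ _).symm (by rw [C.arr_j', LimitArrow.shift_lift]) _
    have ht : t (C.lift a q) =
        M'.limitSpace.tgt (LimitArrow.lift (C.transducer.out a p) g) :=
      C.emb_i'.injective (by rw [← C.tgt_k, hl, 𝒯.tgt_mul, C.tgt_j'])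
    rw [C.run_cons, C.run_cons, apply_cons, ih _ _ _ e' hl, LimitArrow.cocycle_lift]
    exact congrArg (· :: _) (congrFun ht 0)

theorem exists_act_left (g : M.LimitArrow) (p : P) (h : M.limitSpace.tgt g = s p) :
    ∃ q, s q = M.limitSpace.src g ∧
      ∀ w, C.transducer.run q w = C.transducer.run p ((g.cocycle : Equiv.Perm (List A)) w) := by
  have e : 𝒯.tgt (j g) = 𝒯.src (k p) := by rw [C.tgt_j, C.src_k, h]
  obtain ⟨q, hq⟩ := C.exists_k (𝒯.mul (j g) (k p) e) (M.limitSpace.src g) (t p)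
    (by rw [𝒯.src_mul, C.src_j]) (by rw [𝒯.tgt_mul, C.tgt_k])
  exact ⟨q, C.emb_i.injective (by rw [← C.src_k, hq, 𝒯.src_mul, C.src_j]),
    fun w => C.run_act_left w g p q e hq⟩

/-! ### Division -/

theorem exists_div (C : IsCorner F i i' j j' k s t) (z : {z : P × P // s z.1 = s z.2}) : ∃ h, j' h =
    𝒯.mul (𝒯.inv (k z.1.1)) (k z.1.2) (by rw [𝒯.tgt_inv, C.src_k, C.src_k, z.2]) :=
  C.exists_j' _ (t z.1.1) (t z.1.2) (by rw [𝒯.src_mul, 𝒯.src_inv, C.tgt_k])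
    (by rw [𝒯.tgt_mul, C.tgt_k])

/-- The arrow of the second limit space which transforms an element of `P` into another one with
the same source. -/
noncomputable def div (z : {z : P × P // s z.1 = s z.2}) : M'.LimitArrow :=
  (C.exists_div z).choose

theorem j'_div (z : {z : P × P // s z.1 = s z.2}) : j' (C.div z) =
    𝒯.mul (𝒯.inv (k z.1.1)) (k z.1.2) (by rw [𝒯.tgt_inv, C.src_k, C.src_k, z.2]) :=
  (C.exists_div z).choose_spec

theorem src_div (z : {z : P × P // s z.1 = s z.2}) : M'.limitSpace.src (C.div z) = t z.1.1 :=
  C.emb_i'.injective (by rw [← C.src_j', C.j'_div, 𝒯.src_mul, 𝒯.src_inv, C.tgt_k])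

theorem mul_div (z : {z : P × P // s z.1 = s z.2}) : k z.1.2 =
    𝒯.mul (k z.1.1) (j' (C.div z)) (by rw [C.tgt_k, C.src_j', C.src_div]) := by
  have h := 𝒯.mul_inv_mul (k z.1.1) (k z.1.2) (by rw [C.src_k, C.src_k, z.2])
  rw [mul_congr (𝒯 := 𝒯) rfl (C.j'_div z)]
  exact h.symm

theorem run_div (z : {z : P × P // s z.1 = s z.2}) (w : List A) :
    C.transducer.run z.1.2 w =
      ((C.div z).cocycle : Equiv.Perm (List A')) (C.transducer.run z.1.1 w) :=
  C.run_act_right w _ _ _ _ (C.mul_div z)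

theorem continuous_div : Continuous C.div := by
  rw [C.emb_j'.continuous_iff]
  have hc : Continuous fun z : {z : P × P // s z.1 = s z.2} =>
      (⟨(𝒯.inv (k z.1.1), k z.1.2), by rw [𝒯.tgt_inv, C.src_k, C.src_k, z.2]⟩ :
        {p : T × T // 𝒯.tgt p.1 = 𝒯.src p.2}) := by
    refine Continuous.subtype_mk (Continuous.prodMk ?_ ?_) _
    · exact 𝒯.continuous_inv.comp (C.emb_k.continuous.comp
        (continuous_fst.comp continuous_subtype_val))
    · exact C.emb_k.continuous.comp (continuous_snd.comp continuous_subtype_val)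
  exact (𝒯.continuous_mul.comp hc).congr fun z => (C.j'_div z).symm

theorem exists_mul (C : IsCorner F i i' j j' k s t)
    (z : {z : P × M'.LimitArrow // t z.1 = M'.limitSpace.src z.2}) :
    ∃ q, k q = 𝒯.mul (k z.1.1) (j' z.1.2) (by rw [C.tgt_k, C.src_j', z.2]) :=
  C.exists_k _ (s z.1.1) (M'.limitSpace.tgt z.1.2) (by rw [𝒯.src_mul, C.src_k])
    (by simp only [C.tgt_j', 𝒯.tgt_mul])

/-- The action of the arrows of the second limit space. -/
noncomputable def mul (z : {z : P × M'.LimitArrow // t z.1 = M'.limitSpace.src z.2}) : P :=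
  (C.exists_mul z).choose

theorem k_mul (z : {z : P × M'.LimitArrow // t z.1 = M'.limitSpace.src z.2}) :
    k (C.mul z) = 𝒯.mul (k z.1.1) (j' z.1.2) (by rw [C.tgt_k, C.src_j', z.2]) :=
  (C.exists_mul z).choose_spec

theorem s_mul (z : {z : P × M'.LimitArrow // t z.1 = M'.limitSpace.src z.2}) :
    s (C.mul z) = s z.1.1 :=
  C.emb_i.injective (by rw [← C.src_k, C.k_mul, 𝒯.src_mul, C.src_k])

theorem continuous_mul : Continuous C.mul := by
  rw [C.emb_k.continuous_iff]
  have hc : Continuous fun z : {z : P × M'.LimitArrow // t z.1 = M'.limitSpace.src z.2} =>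
      (⟨(k z.1.1, j' z.1.2), by rw [C.tgt_k, C.src_j', z.2]⟩ :
        {p : T × T // 𝒯.tgt p.1 = 𝒯.src p.2}) := by
    refine Continuous.subtype_mk (Continuous.prodMk ?_ ?_) _
    · exact C.emb_k.continuous.comp (continuous_fst.comp continuous_subtype_val)
    · exact C.emb_j'.continuous.comp (continuous_snd.comp continuous_subtype_val)
  exact (𝒯.continuous_mul.comp hc).congr fun z => (C.k_mul z).symm

theorem mul_src_div (z : {z : P × P // s z.1 = s z.2}) :
    C.mul ⟨(z.1.1, C.div z), (C.src_div z).symm⟩ = z.1.2 :=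
  C.emb_k.injective (by rw [C.k_mul, C.mul_div z])

/-! ### Compactness -/

theorem compactSpace (C : IsCorner F i i' j j' k s t)
    [Finite A] [CompactSpace M'.LimitArrow] : CompactSpace P := by
  have hE : IsClosed {z : P × M'.LimitArrow | t z.1 = M'.limitSpace.src z.2} :=
    isClosed_eq (C.continuous_t.comp continuous_fst)
      (M'.limitSpace.continuous_src.comp continuous_snd)
  have hcl : IsClosedMap s := by
    intro K hK
    rw [← C.quotient_s.isClosed_preimage]
    have e : s ⁻¹' (s '' K) = Prod.fst '' (Subtype.val '' (C.mul ⁻¹' K)) := by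
      ext p
      constructor
      · rintro ⟨q, hq, hqp⟩
        exact ⟨_, ⟨⟨(p, C.div ⟨(p, q), hqp.symm⟩), (C.src_div ⟨(p, q), hqp.symm⟩).symm⟩,
          by rw [Set.mem_preimage, C.mul_src_div ⟨(p, q), hqp.symm⟩]; exact hq, rfl⟩, rfl⟩
      · rintro ⟨_, ⟨y, hy, rfl⟩, rfl⟩
        exact ⟨_, hy, C.s_mul y⟩
    rw [e]
    exact isClosedMap_fst_of_compactSpace _
      (hE.isClosedEmbedding_subtypeVal.isClosedMap _ (hK.preimage C.continuous_mul))
  have hfib : ∀ x, IsCompact (s ⁻¹' {x}) := by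
    intro x
    obtain ⟨p, rfl⟩ := C.quotient_s.surjective x
    have hF : IsClosed {h : M'.LimitArrow | t p = M'.limitSpace.src h} :=
      isClosed_eq continuous_const M'.limitSpace.continuous_src
    have := isCompact_iff_compactSpace.1 hF.isCompact
    have hc : Continuous fun h : {h : M'.LimitArrow | t p = M'.limitSpace.src h} =>
        C.mul ⟨(p, h.1), h.2⟩ := by
      refine C.continuous_mul.comp (Continuous.subtype_mk ?_ _)
      exact continuous_const.prodMk continuous_subtype_val
    have e : s ⁻¹' {s p} = Set.range fun h : {h : M'.LimitArrow | t p = M'.limitSpace.src h} =>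
        C.mul ⟨(p, h.1), h.2⟩ := by
      ext q
      constructor
      · intro hq
        exact ⟨⟨C.div ⟨(p, q), hq.symm⟩, (C.src_div ⟨(p, q), hq.symm⟩).symm⟩,
          C.mul_src_div ⟨(p, q), hq.symm⟩⟩
      · rintro ⟨h, rfl⟩
        exact C.s_mul ⟨(p, h.1), h.2⟩
    rw [e]
    exact isCompact_range hc
  have hp : IsProperMap s :=
    isProperMap_iff_isClosedMap_and_compact_fibers.2 ⟨C.continuous_s, hcl, hfib⟩
  exact ⟨hp.isCompact_preimage isCompact_univ⟩

theorem isClosed_eq_s (C : IsCorner F i i' j j' k s t) : IsClosed {z : P × P | s z.1 = s z.2} :=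
  isClosed_eq (C.continuous_s.comp continuous_fst) (C.continuous_s.comp continuous_snd)

theorem isClosed_image_div {K : Set M'.LimitArrow} (hK : IsClosed K) :
    IsClosed {z : P × P | ∃ h : s z.1 = s z.2, C.div ⟨z, h⟩ ∈ K} := by
  have h := C.isClosed_eq_s.isClosedEmbedding_subtypeVal.isClosedMap _
    (hK.preimage C.continuous_div)
  convert h using 1
  ext z
  exact ⟨fun ⟨h, hz⟩ => ⟨⟨z, h⟩, hz, rfl⟩, fun ⟨y, hy, e⟩ => e ▸ ⟨y.2, hy⟩⟩

theorem t2Space (C : IsCorner F i i' j j' k s t) : T2Space P := by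
  rw [t2_iff_isClosed_diagonal]
  have hK : IsClosed {h : M'.LimitArrow | h = M'.limitSpace.one (M'.limitSpace.src h)} :=
    isClosed_eq continuous_id (M'.limitSpace.continuous_one.comp M'.limitSpace.continuous_src)
  convert C.isClosed_image_div hK using 1
  ext ⟨p, q⟩
  constructor
  · rintro (rfl : p = q)
    refine ⟨rfl, C.emb_j'.injective ?_⟩
    rw [C.j'_one, C.src_div, C.j'_div, 𝒯.inv_mul, C.tgt_k]
  · rintro ⟨h, hd⟩
    refine C.emb_k.injective ?_
    rw [C.mul_div ⟨(p, q), h⟩, mul_congr rfl (show _ = 𝒯.one (𝒯.tgt (k p)) from ?_), 𝒯.mul_one]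
    have hd : C.div ⟨(p, q), h⟩ = M'.limitSpace.one (M'.limitSpace.src (C.div ⟨(p, q), h⟩)) := hd
    rw [hd, C.j'_one, C.src_div, C.tgt_k]

end IsCorner
end Transducer

/-- A decreasing sequence of closed subsets of a compact space with intersection in an open set is
eventually contained in it. -/
theorem exists_subset_of_antitone_of_iInter_subset {X : Type*} [TopologicalSpace X]
    [CompactSpace X] {E : ℕ → Set X} (hE : ∀ n, E (n + 1) ⊆ E n) (hc : ∀ n, IsClosed (E n))
    {O : Set X} (hO : IsOpen O) (h : ⋂ n, E n ⊆ O) : ∃ n, E n ⊆ O := by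
  by_contra! hn
  obtain ⟨x, hx⟩ := IsCompact.nonempty_iInter_of_sequence_nonempty_isCompact_isClosed
    (fun n => E n ∩ Oᶜ) (fun n => Set.inter_subset_inter_left _ (hE n))
    (fun n => let ⟨x, h1, h2⟩ := Set.not_subset.1 (hn n); ⟨x, h1, h2⟩)
    ((hc 0).inter hO.isClosed_compl).isCompact fun n => (hc n).inter hO.isClosed_compl
  rw [Set.mem_iInter] at hx
  exact (hx 0).2 (h (Set.mem_iInter.2 fun n => (hx n).1))

namespace NegSeq

variable {S : Type*} {Z : Type*}

/-- The points at which two sequences agree up to a given index. -/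
def agree (f g : Z → NegSeq S) (n : ℕ) : Set Z := {z | ∀ k < n, f z k = g z k}

theorem agree_succ_subset (f g : Z → NegSeq S) (n : ℕ) : agree f g (n + 1) ⊆ agree f g n :=
  fun _ hz k hk => hz k (Nat.lt_succ_of_lt hk)

theorem isClopen_agree [TopologicalSpace Z] {f g : Z → NegSeq S} (hf : Continuous f)
    (hg : Continuous g) (n : ℕ) :
    IsClopen (agree f g n) := by
  have e : agree f g n = ⋂ k ∈ Finset.range n, {z | f z k = g z k} := by
    ext z
    simp [agree]
  rw [e]
  exact isClopen_biInter_finset fun k _ =>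
    ((continuous_iff.1 hf k).prodMk (continuous_iff.1 hg k)).isClopen_setOf fun q => q.1 = q.2

theorem eq_of_mem_iInter_agree {f g : Z → NegSeq S} {z : Z} (h : z ∈ ⋂ n, agree f g n) :
    f z = g z :=
  funext fun k => Set.mem_iInter.1 h (k + 1) k (Nat.lt_succ_self k)

theorem exists_forall_agree [Finite S] {U : Set (NegSeq S)} (hU : IsClopen U) :
    ∃ m : ℕ, ∀ x y : NegSeq S, (∀ k < m, x k = y k) → x ∈ U → y ∈ U := by
  have hO : IsOpen {z : NegSeq S × NegSeq S | z.1 ∈ U → z.2 ∈ U} := by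
    have e : {z : NegSeq S × NegSeq S | z.1 ∈ U → z.2 ∈ U} =
        Prod.fst ⁻¹' Uᶜ ∪ Prod.snd ⁻¹' U := by
      ext z
      exact imp_iff_not_or
    rw [e]
    exact (hU.1.isOpen_compl.preimage continuous_fst).union (hU.2.preimage continuous_snd)
  obtain ⟨m, hm⟩ := exists_subset_of_antitone_of_iInter_subset
    (agree_succ_subset Prod.fst Prod.snd)
    (fun n => (isClopen_agree continuous_fst continuous_snd n).1) hO
    fun z hz => by rw [Set.mem_ofPred_eq, eq_of_mem_iInter_agree hz]; exact id
  exact ⟨m, fun x y h => hm (show (x, y) ∈ _ from h)⟩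

end NegSeq

namespace Transducer

variable {A : Type u} {Q : Type w} {M : Automaton A Q}

theorem sigma_of_run {g : M.group} {q : Q} (h : ⇑(g : Equiv.Perm (List A)) = M.run q) (a : A) :
    M.sigma a g = M.out a q := by
  have h1 := M.apply_singleton a g
  rw [h] at h1
  exact (List.cons.inj h1).1.symm

theorem tau_of_run {g h : M.group} {q : Q} {a : A} (hg : ⇑(g : Equiv.Perm (List A)) = M.run q)
    (hh : ⇑(h : Equiv.Perm (List A)) = M.run (M.trans a q)) : M.tau [a] g = h := by
  apply M.group_ext
  intro w
  have h1 := M.apply_cons g a w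
  rw [hg] at h1
  rw [hh]
  exact (List.cons.inj h1).2.symm

/-- If the transition map is surjective, every state is the value of the cocycle on an arrow of
the limit space. -/
theorem exists_cocycle_eq [Finite Q] (hs : ∀ q, ∃ a p, M.trans a p = q) {γ : Q → M.group}
    (hγ : ∀ q, ⇑(γ q : Equiv.Perm (List A)) = M.run q) (q : Q) :
    ∃ g : M.LimitArrow, g.cocycle = γ q := by
  choose a p hp using hs
  let r : ℕ → Q := fun n => p^[n] q
  have hr : ∀ k, M.tau [a (r k)] (γ (r (k + 1))) = γ (r k) := fun k => by
    refine tau_of_run (hγ _) ?_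
    have : r (k + 1) = p (r k) := Function.iterate_succ_apply' _ _ _
    rw [this, hp, hγ]
  exact ⟨⟨(fun k => a (r k), fun k => γ (r (k + 1))), fun k => (hr (k + 1)).symm,
    (Set.finite_range γ).subset (Set.range_subset_iff.2 fun k => ⟨_, rfl⟩)⟩, hr 0⟩

/-- The tile of a smooth automaton is connected. -/
theorem Smooth.eq_univ [Finite A] [Finite Q] (hM : M.Smooth) {γ : Q → M.group}
    (hγ : ∀ q, ⇑(γ q : Equiv.Perm (List A)) = M.run q) {U : Set (NegSeq A)} (hU : IsClopen U)
    (hinv : ∀ g : M.LimitArrow, g.cocycle = 1 → M.limitSpace.src g ∈ U → M.limitSpace.tgt g ∈ U)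
    (hne : U.Nonempty) : U = Set.univ := by
  obtain ⟨m, hm⟩ := NegSeq.exists_forall_agree hU
  clear hU
  induction m generalizing U with
  | zero =>
    obtain ⟨x, hx⟩ := hne
    exact Set.eq_univ_of_forall fun y => hm x y (fun k hk => absurd hk (Nat.not_lt_zero k)) hx
  | succ m ih =>
    have hpre : ∀ a, (NegSeq.cons a ⁻¹' U).Nonempty → NegSeq.cons a ⁻¹' U = Set.univ := by
      intro a ha
      refine ih (fun g hg h => ?_) ha fun x y hxy h => ?_
      · have h1 := hinv (LimitArrow.lift a g)
          (by rw [LimitArrow.cocycle_lift, hg, tau_one]) h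
        rwa [LimitArrow.tgt_lift, hg, sigma_one] at h1
      · refine hm _ _ (fun k hk => ?_) h
        cases k with
        | zero => rfl
        | succ k => exact hxy k (Nat.lt_of_succ_lt_succ hk)
    obtain ⟨x, hx⟩ := hne
    have h0 : NegSeq.cons (x 0) ⁻¹' U = Set.univ :=
      hpre _ ⟨x.shift, by rw [Set.mem_preimage, NegSeq.cons_shift]; exact hx⟩
    have hall : ∀ b, NegSeq.cons b ⁻¹' U = Set.univ := by
      intro b
      induction hM.2 (x 0) b with
      | refl => exact h0
      | @tail b c _ hbc hb =>
        obtain ⟨q, hq, hid⟩ := hbc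
        obtain ⟨g, hg⟩ := exists_cocycle_eq hM.1 hγ q
        have h1 : (LimitArrow.lift b g).cocycle = 1 := by
          rw [LimitArrow.cocycle_lift, hg]
          exact tau_of_run (hγ q) (by rw [hid]; rfl)
        have h2 := hinv _ h1 (show M.limitSpace.src g ∈ NegSeq.cons b ⁻¹' U from
          hb ▸ Set.mem_univ _)
        rw [LimitArrow.tgt_lift, hg, sigma_of_run (hγ q), hq] at h2
        exact hpre c ⟨_, h2⟩
    refine Set.eq_univ_of_forall fun y => ?_
    have : y.shift ∈ NegSeq.cons (y 0) ⁻¹' U := hall (y 0) ▸ Set.mem_univ _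
    rwa [Set.mem_preimage, NegSeq.cons_shift] at this

/-- A transducer whose states give finitely many maps can be replaced by a finite one. -/
theorem exists_finite {B B' R : Type*} (N : Transducer B B' R)
    (h : (Set.range N.run).Finite) (r : R) :
    ∃ (S : Type) (_ : Finite S) (N' : Transducer B B' S) (s : S), N.run r = N'.run s := by
  have := h.to_subtype
  obtain ⟨n, ⟨e⟩⟩ := Finite.exists_equiv_fin (Set.range N.run)
  choose rep hrep using fun f : Set.range N.run => f.2
  let N' : Transducer B B' (Fin n) :=
    { out := fun b s => N.out b (rep (e.symm s))
      trans := fun b s => e ⟨_, N.trans b (rep (e.symm s)), rfl⟩ }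
  have key : ∀ (w : List B) (s : Fin n), N'.run s w = (e.symm s).1 w := by
    intro w
    induction w with
    | nil => intro s; rw [← hrep]; rfl
    | cons b w ih =>
      intro s
      rw [← hrep]
      show _ :: N'.run (e ⟨_, N.trans b (rep (e.symm s)), rfl⟩) w = _ :: _
      rw [ih, Equiv.symm_apply_apply]
  exact ⟨Fin n, inferInstance, N', e ⟨_, r, rfl⟩, by
    funext w; rw [key, Equiv.symm_apply_apply]⟩

open TopGroupoid

variable {A' : Type v} {Q' : Type x} {M' : Automaton A' Q'}

namespace IsCorner

variable {Y T : Type z} [TopologicalSpace Y] [TopologicalSpace T] {𝒯 : TopGroupoid Y T}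
  {F : 𝒯.SelfCovering} {i : NegSeq A → Y} {i' : NegSeq A' → Y} {j : M.LimitArrow → T}
  {j' : M'.LimitArrow → T} {P : Type*} [TopologicalSpace P] {k : P → T}
  {s : P → NegSeq A} {t : P → NegSeq A'} (C : IsCorner F i i' j j' k s t)
  {P₂ : Type*} [TopologicalSpace P₂] {k₂ : P₂ → T} {s₂ : P₂ → NegSeq A'} {t₂ : P₂ → NegSeq A}
  (C₂ : IsCorner F i' i j' j k₂ s₂ t₂)

theorem run_inv (w : List A) (p : P) (q : P₂) (h : k₂ q = 𝒯.inv (k p)) :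
    C₂.transducer.run q (C.transducer.run p w) = w := by
  induction w generalizing p q with
  | nil => rfl
  | cons a w ih =>
    have hs : s₂ q = t p := C.emb_i'.injective (by rw [← C₂.src_k, h, 𝒯.src_inv, C.tgt_k])
    have hl : k₂ (C₂.lift (C.transducer.out a p) q) = 𝒯.inv (k (C.lift a p)) := by
      apply F.ext_lift
      · rw [C₂.src_k, C₂.s_lift, 𝒯.src_inv, C.tgt_k, C.t_lift, hs]
      · rw [C₂.arr_lift, F.map_inv, C.arr_lift, h]
    have ht : t₂ (C₂.lift (C.transducer.out a p) q) = s (C.lift a p) :=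
      C.emb_i.injective (by rw [← C₂.tgt_k, hl, 𝒯.tgt_inv, C.src_k])
    rw [C.run_cons, C₂.run_cons, ih _ _ hl]
    rw [C.s_lift] at ht
    exact congrArg (· :: _) (congrFun ht 0)

theorem exists_inv (C : IsCorner F i i' j j' k s t)
    (C₂ : IsCorner F i' i j' j k₂ s₂ t₂) (p : P) : ∃ q : P₂, k₂ q = 𝒯.inv (k p) :=
  C₂.exists_k _ (t p) (s p) (by rw [𝒯.src_inv, C.tgt_k]) (by rw [𝒯.tgt_inv, C.src_k])

theorem exists_run_inverse (p : P) : ∃ q : P₂,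
    Function.LeftInverse (C₂.transducer.run q) (C.transducer.run p) ∧
    Function.RightInverse (C₂.transducer.run q) (C.transducer.run p) := by
  obtain ⟨q, hq⟩ := C.exists_inv C₂ p
  obtain ⟨p', hp'⟩ := C₂.exists_inv C q
  refine ⟨q, fun w => C.run_inv C₂ w p q hq, fun w => ?_⟩
  have hinj : Function.Injective (C₂.transducer.run q) :=
    Function.LeftInverse.injective fun w => C₂.run_inv C w q p' hp'
  exact hinj (C.run_inv C₂ _ p q hq)

/-- The action on the iterated preimages of the source is locally constant. -/
theorem locallyConstant_run [Finite A] [CompactSpace P] [T2Space P]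
    (hsurj : ∀ p, Function.Surjective (C.transducer.run p)) :
    IsLocallyConstant C.transducer.run := by
  have hdiv : ∀ z : {z : P × P // s z.1 = s z.2}, (C.div z).cocycle = 1 ↔
      C.transducer.run z.1.1 = C.transducer.run z.1.2 := by
    intro z
    constructor
    · intro h
      funext w
      rw [C.run_div, h]
      rfl
    · intro h
      refine M'.group_ext fun w => ?_
      obtain ⟨u, rfl⟩ := hsurj z.1.1 w
      rw [← C.run_div, ← h]
      rfl
  have hcl : ∀ R : M'.group → Prop, IsClosed {z : P × P | ∃ h : s z.1 = s z.2,
      R (C.div ⟨z, h⟩).cocycle} := fun R =>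
    C.isClosed_image_div (LimitArrow.locallyConstant_cocycle.isClopen_setOf R).1
  have ht : IsClosed {z : P × P | t z.1 = t z.2} :=
    isClosed_eq (C.continuous_t.comp continuous_fst) (C.continuous_t.comp continuous_snd)
  let W₁ : Set (P × P) := {z | s z.1 = s z.2 ∧ t z.1 = t z.2 ∧
    C.transducer.run z.1 = C.transducer.run z.2}
  let W₂ : Set (P × P) := {z | s z.1 = s z.2 ∧ t z.1 = t z.2 ∧
    C.transducer.run z.1 ≠ C.transducer.run z.2}
  have hW₁ : IsClosed W₁ := by
    convert (hcl fun g => g = 1).inter ht using 1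
    ext z
    exact ⟨fun ⟨h1, h2, h3⟩ => ⟨⟨h1, (hdiv ⟨z, h1⟩).2 h3⟩, h2⟩,
      fun ⟨⟨h1, h3⟩, h2⟩ => ⟨h1, h2, (hdiv ⟨z, h1⟩).1 h3⟩⟩
  have hW₂ : IsClosed W₂ := by
    convert (hcl fun g => g ≠ 1).inter ht using 1
    ext z
    exact ⟨fun ⟨h1, h2, h3⟩ => ⟨⟨h1, fun h => h3 ((hdiv ⟨z, h1⟩).1 h)⟩, h2⟩,
      fun ⟨⟨h1, h3⟩, h2⟩ => ⟨h1, h2, fun h => h3 ((hdiv ⟨z, h1⟩).2 h)⟩⟩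
  obtain ⟨V, hVo, hWV, hVW⟩ := normal_exists_closure_subset hW₂ hW₁.isOpen_compl
    fun z h2 h1 => h2.2.2 h1.2.2
  let U : Set (P × P) := (closure V)ᶜ ∩ ⋂ a, {z | (C.lift a z.1, C.lift a z.2) ∈ (closure V)ᶜ} ∩
    {z | C.transducer.out a z.1 = C.transducer.out a z.2}
  have hU : IsOpen U := by
    refine isClosed_closure.isOpen_compl.inter (isOpen_iInter_of_finite fun a => IsOpen.inter ?_ ?_)
    · exact isClosed_closure.isOpen_compl.preimage
        (((C.continuous_lift a).comp continuous_fst).prodMk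
          ((C.continuous_lift a).comp continuous_snd))
    · exact ((((C.locallyConstant_out a).comp_continuous continuous_fst).prodMk
        ((C.locallyConstant_out a).comp_continuous continuous_snd)).isClopen_setOf
          fun q => q.1 = q.2).2
  have hWU : W₁ ⊆ U := by
    intro z hz
    have hc : ∀ y ∈ W₁, y ∈ (closure V)ᶜ := fun y hy hy' => hVW hy' hy
    refine ⟨hc z hz, Set.mem_iInter.2 fun a => ?_⟩
    obtain ⟨h1, h2, h3⟩ := hz
    have ho : ∀ w, C.transducer.run z.1 (a :: w) = C.transducer.run z.2 (a :: w) :=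
      fun w => by rw [h3]
    simp only [C.run_cons, List.cons.injEq] at ho
    exact ⟨hc _ ⟨by rw [C.s_lift, C.s_lift, h1], by rw [C.t_lift, C.t_lift, (ho []).1, h2],
      funext fun w => (ho w).2⟩, (ho []).1⟩
  let E : ℕ → Set (P × P) := fun n => NegSeq.agree (fun z => s z.1) (fun z => s z.2) n ∩
    NegSeq.agree (fun z => t z.1) (fun z => t z.2) n
  have hE : ∀ n, IsClopen (E n) := fun n =>
    (NegSeq.isClopen_agree (C.continuous_s.comp continuous_fst)
      (C.continuous_s.comp continuous_snd) n).inter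
    (NegSeq.isClopen_agree (C.continuous_t.comp continuous_fst)
      (C.continuous_t.comp continuous_snd) n)
  obtain ⟨n, hn⟩ := exists_subset_of_antitone_of_iInter_subset (E := E)
    (fun n => Set.inter_subset_inter (NegSeq.agree_succ_subset _ _ n)
      (NegSeq.agree_succ_subset _ _ n)) (fun n => (hE n).1) (hU.union hVo) (by
    intro z hz
    rw [Set.iInter_inter_distrib] at hz
    have h1 : s z.1 = s z.2 := NegSeq.eq_of_mem_iInter_agree hz.1
    have h2 : t z.1 = t z.2 := NegSeq.eq_of_mem_iInter_agree hz.2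
    by_cases h3 : C.transducer.run z.1 = C.transducer.run z.2
    · exact Or.inl (hWU ⟨h1, h2, h3⟩)
    · exact Or.inr (hWV ⟨h1, h2, h3⟩))
  have key : ∀ (w : List A) (p q : P), (p, q) ∈ U ∩ E n →
      C.transducer.run p w = C.transducer.run q w := by
    intro w
    induction w with
    | nil => exact fun _ _ _ => rfl
    | cons a w ih =>
      rintro p q ⟨hpU, hpE⟩
      obtain ⟨h1, h2⟩ := Set.mem_iInter.1 hpU.2 a
      have h2 : C.transducer.out a p = C.transducer.out a q := h2
      have hl : (C.lift a p, C.lift a q) ∈ E n := by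
        constructor
        · intro m hm
          show s (C.lift a p) m = s (C.lift a q) m
          rw [C.s_lift, C.s_lift]
          cases m with
          | zero => rfl
          | succ m => exact hpE.1 m (Nat.lt_of_succ_lt hm)
        · intro m hm
          show t (C.lift a p) m = t (C.lift a q) m
          rw [C.t_lift, C.t_lift, h2]
          cases m with
          | zero => rfl
          | succ m => exact hpE.2 m (Nat.lt_of_succ_lt hm)
      rw [C.run_cons, C.run_cons, h2,
        ih _ _ ⟨(hn hl).resolve_right fun h => h1 (subset_closure h), hl⟩]
  rw [IsLocallyConstant.iff_eventually_eq]
  intro p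
  have hp : (p, p) ∈ U ∩ E n := ⟨hWU ⟨rfl, rfl, rfl⟩, fun _ _ => rfl, fun _ _ => rfl⟩
  have hnhds : ∀ᶠ q in 𝓝 p, (p, q) ∈ U ∩ E n :=
    (Continuous.prodMk_right p).continuousAt.eventually ((hU.inter (hE n).2).mem_nhds hp)
  filter_upwards [hnhds] with q hq
  exact funext fun w => (key w p q hq).symm

variable [Finite A] [Finite Q]

theorem exists_run_eq (hloc : IsLocallyConstant C.transducer.run) (hM : M.Smooth) {γ : Q → M.group}
    (hγ : ∀ q, ⇑(γ q : Equiv.Perm (List A)) = M.run q) (p₀ p : P) :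
    ∃ h : M'.group, ∀ w, C.transducer.run p w =
      (h : Equiv.Perm (List A')) (C.transducer.run p₀ w) := by
  let B : Set P := {p | ∃ h : M'.group, ∀ w, C.transducer.run p w =
    (h : Equiv.Perm (List A')) (C.transducer.run p₀ w)}
  have hB : ∀ p q, s p = s q → p ∈ B → q ∈ B := by
    rintro p q hpq ⟨h, hh⟩
    refine ⟨(C.div ⟨(p, q), hpq⟩).cocycle * h, fun w => ?_⟩
    rw [C.run_div ⟨(p, q), hpq⟩, hh]
    rfl
  have hpre : s ⁻¹' (s '' B) = B :=
    Set.Subset.antisymm (fun q ⟨p, hp, e⟩ => hB p q e hp) (Set.subset_preimage_image s B)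
  have hBc : IsClopen B := hloc.isClopen_setOf fun f => ∃ h : M'.group, ∀ w, f w =
    (h : Equiv.Perm (List A')) (C.transducer.run p₀ w)
  have hclopen : IsClopen (s '' B) :=
    ⟨C.quotient_s.isClosed_preimage.1 (hpre.symm ▸ hBc.1),
      C.quotient_s.isOpen_preimage.1 (hpre.symm ▸ hBc.2)⟩
  have huniv : s '' B = Set.univ := by
    refine hM.eq_univ hγ hclopen ?_ ⟨s p₀, p₀, ⟨1, fun w => rfl⟩, rfl⟩
    rintro g hg ⟨r, hr, hrg⟩
    obtain ⟨q, hq⟩ := C.quotient_s.surjective (M.limitSpace.tgt g)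
    obtain ⟨q', hq', hrun⟩ := C.exists_act_left g q hq.symm
    obtain ⟨h, hh⟩ := hB r q' (hrg.trans hq'.symm) hr
    refine ⟨q, ⟨h, fun w => ?_⟩, hq⟩
    rw [← hh, hrun, hg]
    rfl
  obtain ⟨q, hq, e⟩ : s p ∈ s '' B := huniv ▸ Set.mem_univ _
  exact hB q p e hq

theorem exists_conj (hloc : IsLocallyConstant C.transducer.run) (hM : M.Smooth) {γ : Q → M.group}
    (hγ : ∀ q, ⇑(γ q : Equiv.Perm (List A)) = M.run q) (p₀ : P) {g : Equiv.Perm (List A)}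
    (hg : g ∈ M.group) : ∃ h : M'.group, ∀ w, C.transducer.run p₀ (g w) =
      (h : Equiv.Perm (List A')) (C.transducer.run p₀ w) := by
  induction hg using Subgroup.closure_induction with
  | mem x hx =>
    obtain ⟨q, hq⟩ := hx
    obtain ⟨g, hg⟩ := exists_cocycle_eq hM.1 hγ q
    obtain ⟨p, hp⟩ := C.quotient_s.surjective (M.limitSpace.tgt g)
    obtain ⟨p', -, hrun⟩ := C.exists_act_left g p hp.symm
    obtain ⟨h, hh⟩ := C.exists_run_eq hloc hM hγ p₀ p
    obtain ⟨h', hh'⟩ := C.exists_run_eq hloc hM hγ p₀ p'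
    refine ⟨h⁻¹ * h', fun w => ?_⟩
    have h1 := hrun w
    rw [hh, hh', hg, hγ, ← hq] at h1
    rw [Subgroup.coe_mul, Equiv.Perm.mul_apply, h1]
    simp
  | one => exact ⟨1, fun w => rfl⟩
  | mul x y _ _ hx hy =>
    obtain ⟨h, hh⟩ := hx
    obtain ⟨h', hh'⟩ := hy
    refine ⟨h * h', fun w => ?_⟩
    rw [Equiv.Perm.mul_apply, hh, hh']
    rfl
  | inv x _ hx =>
    obtain ⟨h, hh⟩ := hx
    refine ⟨h⁻¹, fun w => ?_⟩
    have h1 := hh (x⁻¹ w)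
    rw [← Equiv.Perm.mul_apply, mul_inv_cancel, Equiv.Perm.one_apply] at h1
    rw [h1]
    simp

theorem equivalent (C : IsCorner F i i' j j' k s t)
    (C₂ : IsCorner F i' i j' j k₂ s₂ t₂) [Finite A'] [Finite Q']
    [CompactSpace M.LimitArrow] [CompactSpace M'.LimitArrow]
    (hM : M.Smooth) (hM' : M'.Smooth) {γ : Q → M.group} {γ' : Q' → M'.group}
    (hγ : ∀ q, ⇑(γ q : Equiv.Perm (List A)) = M.run q)
    (hγ' : ∀ q, ⇑(γ' q : Equiv.Perm (List A')) = M'.run q) (p₀ : P) : M.Equivalent M' := by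
  have := C.compactSpace
  have := C₂.compactSpace
  have := C.t2Space
  have := C₂.t2Space
  have hloc := C.locallyConstant_run fun p =>
    let ⟨_, _, h⟩ := C.exists_run_inverse C₂ p; h.surjective
  have hloc₂ := C₂.locallyConstant_run fun p =>
    let ⟨_, _, h⟩ := C₂.exists_run_inverse C p; h.surjective
  obtain ⟨q₀, hl, hr⟩ := C.exists_run_inverse C₂ p₀
  let φ : List A ≃ List A' := ⟨C.transducer.run p₀, C₂.transducer.run q₀, hl, hr⟩
  have hφ : IsTreeMap ⇑φ := C.transducer.run_isTreeMap p₀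
  have hconj₂ : ∀ h : M'.group, ∃ g : M.group, ∀ w, (h : Equiv.Perm (List A')) (φ w) =
      φ ((g : Equiv.Perm (List A)) w) := by
    intro h
    obtain ⟨g, hg⟩ := C₂.exists_conj hloc₂ hM' hγ' q₀ h.2
    refine ⟨g, fun w => ?_⟩
    have h1 : φ.symm ((h : Equiv.Perm (List A')) (φ w)) =
        (g : Equiv.Perm (List A)) (φ.symm (φ w)) := hg (φ w)
    rw [Equiv.symm_apply_apply] at h1
    rw [← h1, Equiv.apply_symm_apply]
  obtain ⟨l, -⟩ := exists_letter_equiv hφ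
  refine ⟨⟨l⟩, φ, ?_, fun v => ?_, ?_⟩
  · exact C.transducer.exists_finite (hloc.range_finite) p₀
  · obtain ⟨p, hp⟩ := C.transducer.wordSection_run p₀ v
    obtain ⟨h, hh⟩ := C.exists_run_eq hloc hM hγ p₀ p
    obtain ⟨g, hg⟩ := hconj₂ h
    refine ⟨g, g.2, hp.trans (funext fun w => (hh w).trans (hg w))⟩
  · ext f
    constructor
    · rintro ⟨g, hg, rfl⟩
      obtain ⟨h, hh⟩ := C.exists_conj hloc hM hγ p₀ hg
      have e : φ.permCongr g = h := by
        ext1 w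
        obtain ⟨u, rfl⟩ := φ.surjective w
        rw [Equiv.permCongr_apply, Equiv.symm_apply_apply]
        exact hh u
      show φ.permCongr g ∈ (M'.group : Set (Equiv.Perm (List A')))
      rw [e]
      exact h.2
    · intro hf
      obtain ⟨g, hg⟩ := hconj₂ ⟨f, hf⟩
      refine ⟨g, g.2, ?_⟩
      ext1 w
      obtain ⟨u, rfl⟩ := φ.surjective w
      show φ.permCongr (g : Equiv.Perm (List A)) (φ u) = _
      rw [Equiv.permCongr_apply, Equiv.symm_apply_apply]
      exact (hg u).symm

end IsCorner
end Transducer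

namespace TopGroupoid

section Idempotent

variable {X G : Type u} [TopologicalSpace X] [TopologicalSpace G] (𝒢 : TopGroupoid X G)

theorem eq_one_of_mul_self {g : G} (e : 𝒢.tgt g = 𝒢.src g) (h : 𝒢.mul g g e = g) :
    g = 𝒢.one (𝒢.src g) := by
  have h1 := 𝒢.mul_assoc (𝒢.inv g) g g (𝒢.tgt_inv g) e
  simp only [h, 𝒢.inv_mul] at h1
  have h2 : ∀ (y : X) (hy : 𝒢.src g = y) (e' : 𝒢.tgt (𝒢.one y) = 𝒢.src g),
      𝒢.mul (𝒢.one y) g e' = g := by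
    rintro y rfl e'
    exact 𝒢.one_mul g
  rw [← e, ← h1, h2 _ e.symm]

end Idempotent

namespace Linking

variable {X G : Type u} [TopologicalSpace X] [TopologicalSpace G]
  {X' G' : Type v} [TopologicalSpace X'] [TopologicalSpace G']
  {𝒢 : TopGroupoid X G} {𝒢' : TopGroupoid X' G'}
  {P : Type (max u v)} [TopologicalSpace P] (L : Linking 𝒢 𝒢' P)

theorem inl_one (x : X) : Sum.inl (𝒢.one x) = L.total.one (Sum.inl x) := by
  have e : 𝒢.tgt (𝒢.one x) = 𝒢.src (𝒢.one x) := by rw [𝒢.tgt_one, 𝒢.src_one]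
  have e' : L.total.tgt (Sum.inl (𝒢.one x)) = L.total.src (Sum.inl (𝒢.one x)) := by
    rw [L.src_inl, L.tgt_inl, e]
  have h1 := 𝒢.one_mul (𝒢.one x)
  simp only [𝒢.src_one] at h1
  rw [L.total.eq_one_of_mul_self e' (by rw [L.mul_left _ _ e, h1]), L.src_inl, 𝒢.src_one]

theorem inr_one (x : X') :
    Sum.inr (Sum.inr (Sum.inr (𝒢'.one x))) = L.total.one (Sum.inr x) := by
  have e : 𝒢'.tgt (𝒢'.one x) = 𝒢'.src (𝒢'.one x) := by rw [𝒢'.tgt_one, 𝒢'.src_one]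
  have e' : L.total.tgt (Sum.inr (Sum.inr (Sum.inr (𝒢'.one x)))) =
      L.total.src (Sum.inr (Sum.inr (Sum.inr (𝒢'.one x)))) := by
    rw [L.src_inr_inr_inr, L.tgt_inr_inr_inr, e]
  have h1 := 𝒢'.one_mul (𝒢'.one x)
  simp only [𝒢'.src_one] at h1
  rw [L.total.eq_one_of_mul_self e' (by rw [L.mul_right _ _ e, h1]), L.src_inr_inr_inr,
    𝒢'.src_one]

variable {L}

theorem IsMorita.isQuotientMap_srcP (h : L.IsMorita) : IsQuotientMap L.srcP :=
  h.1.isQuotientMap.comp isQuotientMap_quot_mk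

theorem IsMorita.isQuotientMap_tgtP (h : L.IsMorita) : IsQuotientMap L.tgtP :=
  h.2.isQuotientMap.comp isQuotientMap_quot_mk

end Linking

end TopGroupoid

namespace Transducer

open TopGroupoid

variable {A : Type u} {Q : Type w} {A' : Type v} {Q' : Type x}
  {M : Automaton A Q} {M' : Automaton A' Q'}
  {P : Type (max u v)} [TopologicalSpace P] {L : Linking M.limitSpace M'.limitSpace P}

theorem isCorner_left (F : SelfCovering L.total) (hL : L.IsMorita)
    (h1 : ∀ x, F.obj (Sum.inl x) = Sum.inl (M.limitShift.obj x))
    (h2 : ∀ x, F.obj (Sum.inr x) = Sum.inr (M'.limitShift.obj x))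
    (h3 : ∀ g, F.arr (Sum.inl g) = Sum.inl (M.limitShift.arr g))
    (h4 : ∀ g, F.arr (Sum.inr (Sum.inr (Sum.inr g))) =
      Sum.inr (Sum.inr (Sum.inr (M'.limitShift.arr g)))) :
    IsCorner F Sum.inl Sum.inr Sum.inl (fun g => Sum.inr (Sum.inr (Sum.inr g)))
      (fun p => Sum.inr (Sum.inl p)) L.srcP L.tgtP where
  emb_i := IsEmbedding.inl
  emb_i' := IsEmbedding.inr
  emb_j' := IsEmbedding.inr.comp (IsEmbedding.inr.comp IsEmbedding.inr)
  emb_k := IsEmbedding.inr.comp IsEmbedding.inl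
  src_j := L.src_inl
  tgt_j := L.tgt_inl
  src_j' := L.src_inr_inr_inr
  tgt_j' := L.tgt_inr_inr_inr
  src_k := L.src_inr_inl
  tgt_k := L.tgt_inr_inl
  exists_k _ _ _ := L.exists_inr_inl
  exists_j' _ _ _ := L.exists_inr_inr_inr
  obj_i := h1
  obj_i' := h2
  exists_i' y x h := by
    rcases y with y | y
    · rw [h1] at h
      exact absurd h Sum.inl_ne_inr
    · exact ⟨y, rfl⟩
  arr_j := h3
  arr_j' := h4
  j'_one := L.inr_one
  quotient_s := hL.isQuotientMap_srcP

theorem isCorner_right (F : SelfCovering L.total) (hL : L.IsMorita)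
    (h1 : ∀ x, F.obj (Sum.inl x) = Sum.inl (M.limitShift.obj x))
    (h2 : ∀ x, F.obj (Sum.inr x) = Sum.inr (M'.limitShift.obj x))
    (h3 : ∀ g, F.arr (Sum.inl g) = Sum.inl (M.limitShift.arr g))
    (h4 : ∀ g, F.arr (Sum.inr (Sum.inr (Sum.inr g))) =
      Sum.inr (Sum.inr (Sum.inr (M'.limitShift.arr g)))) :
    IsCorner F Sum.inr Sum.inl (fun g => Sum.inr (Sum.inr (Sum.inr g))) Sum.inl
      (fun p => Sum.inr (Sum.inr (Sum.inl p))) L.tgtP L.srcP where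
  emb_i := IsEmbedding.inr
  emb_i' := IsEmbedding.inl
  emb_j' := IsEmbedding.inl
  emb_k := IsEmbedding.inr.comp (IsEmbedding.inr.comp IsEmbedding.inl)
  src_j := L.src_inr_inr_inr
  tgt_j := L.tgt_inr_inr_inr
  src_j' := L.src_inl
  tgt_j' := L.tgt_inl
  src_k := L.src_inr_inr_inl
  tgt_k := L.tgt_inr_inr_inl
  exists_k _ _ _ := L.exists_inr_inr_inl
  exists_j' _ _ _ := L.exists_inl
  obj_i := h2
  obj_i' := h1
  exists_i' y x h := by
    rcases y with y | y
    · exact ⟨y, rfl⟩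
    · rw [h2] at h
      exact absurd h Sum.inr_ne_inl
  arr_j := h4
  arr_j' := h3
  j'_one := L.inl_one
  quotient_s := hL.isQuotientMap_tgtP

theorem equivalent_of_isEmpty [IsEmpty A] [IsEmpty A'] : M.Equivalent M' := by
  let φ : List A ≃ List A' := Equiv.ofUnique _ _
  refine ⟨⟨Equiv.equivOfIsEmpty A A'⟩, φ, ⟨Unit, inferInstance, ⟨isEmptyElim, isEmptyElim⟩, (),
    funext fun w => Subsingleton.elim _ _⟩, fun v => ⟨1, one_mem _, funext fun w =>
    Subsingleton.elim _ _⟩, ?_⟩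
  ext f
  have hf : f = 1 := Equiv.ext fun w => Subsingleton.elim _ _
  exact ⟨fun _ => hf ▸ one_mem M'.group, fun _ => ⟨1, one_mem M.group,
    Equiv.ext fun w => Subsingleton.elim _ _⟩⟩

theorem equivalent_of_moritaEquivalent [Finite A] [Finite A'] (hN : M.Nuclear) (hN' : M'.Nuclear)
    (hM : M.Smooth) (hM' : M'.Smooth)
    (h : MoritaEquivalent M.limitShift M'.limitShift) : M.Equivalent M' := by
  obtain ⟨P, _, L, F, hL, h1, h2, h3, h4⟩ := h
  have C := isCorner_left F hL h1 h2 h3 h4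
  have C₂ := isCorner_right F hL h1 h2 h3 h4
  by_cases hP : Nonempty P
  · obtain ⟨p₀⟩ := hP
    have := hN.1.compactSpace_limitArrow
    have := hN'.1.compactSpace_limitArrow
    have := hN.finite
    have := hN'.finite
    obtain ⟨-, e, he⟩ := hN
    obtain ⟨-, e', he'⟩ := hN'
    exact C.equivalent C₂ hM hM' (γ := fun q => e q) (γ' := fun q => e' q) he he' p₀
  · have hA : IsEmpty A := ⟨fun a => hP ⟨(C.quotient_s.surjective fun _ => a).choose⟩⟩
    have hA' : IsEmpty A' := ⟨fun a => hP ⟨(C₂.quotient_s.surjective fun _ => a).choose⟩⟩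
    exact equivalent_of_isEmpty

end Transducer

theorem mainTheorem3 {A : Type u} {Q : Type w} {A' : Type v} {Q' : Type x}
    [Finite A] [Finite A'] (M : Automaton A Q) (M' : Automaton A' Q')
    (hM : M.Invertible) (hM' : M'.Invertible) (hN : M.Nuclear) (hN' : M'.Nuclear) :
    (M.Equivalent M' → TopGroupoid.MoritaEquivalent M.limitShift M'.limitShift) ∧
    (M.Smooth → M'.Smooth →
      (M.Equivalent M' ↔ TopGroupoid.MoritaEquivalent M.limitShift M'.limitShift)) := by
  have h : M.Equivalent M' → TopGroupoid.MoritaEquivalent M.limitShift M'.limitShift := fun h =>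
    let ⟨D⟩ := h.exists_treeConj
    D.moritaEquivalent hN.1 hN'.1
  exact ⟨h, fun hS hS' => ⟨h, Transducer.equivalent_of_moritaEquivalent hN hN' hS hS'⟩⟩
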